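/- Let $n\ge 2$ and $\mu>5$ be integers, let $x_1,\dots,x_{2n}$ be the coordinates on $\mathbb R^{2n}$, and let $$S_\mu=\{x\in\mathbb R^{2n}: x_1^2-x_2^2-x_3^{\mu-3}=x_2x_3=0,\ x_i=0 \text{ for } i\ge 4\}.$$ Let $\Lambda^p$ be the space of germs at $0$ of smooth differential $p$-forms on $\mathbb R^{2n}$, and $\Lambda^p_{S_\mu}\subset\Lambda^p$ the subspace of germs $\omega$ such that all coefficients of $\omega$ vanish at every point of the germ of $S_\mu$ at $0$. The algebraic restriction $[\omega]_{S_\mu}$ of $\omega\in\Lambda^2$ is the class of $\omega$ in $[\Lambda^2(\mathbb R^{2n})]_{S_\mu}=\Lambda^2/\{\alpha+d\beta:\alpha\in\Lambda^2_{S_\mu},\ \beta\in\Lambda^1_{S_\mu}\}$. Let $[Z^2(\mathbb R^{2n})]_{S_\mu}$ and $[\mathrm{Symp}(\mathbb R^{2n})]_{S_\mu}$ be the sets of algebraic restrictions of germs of closed $2$-forms and of germs of symplectic forms, respectively. Put $$\theta_1=dx_1\wedge dx_3,\quad \theta_2=dx_2\wedge dx_3,\quad \theta_3=dx_1\wedge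 dx_2,\quad \sigma_1=x_3\,dx_1\wedge dx_2,\quad \sigma_2=x_1\,dx_2\wedge dx_3,$$ $$\theta_4=\sigma_1-\sigma_2,\qquad \theta_{4+k}=x_3^k\,dx_1\wedge dx_3\quad(1\le k\le\mu-4).$$ 1. The vector space $[\Lambda^2(\mathbb R^{2n})]_{S_\mu}$ has dimension $\mu+1$ and is spanned by the algebraic restrictions of $\theta_1,\theta_2,\theta_3,\sigma_1,\sigma_2$ and $\theta_{4+k}$, $1\le k\le\mu-4$. 2. The subspace $[Z^2(\mathbb R^{2n})]_{S_\mu}$ has dimension $\mu$ and is spanned by the algebraic restrictions of $\theta_1,\dots,\theta_\mu$. 3. If $n\ge3$, then $[\mathrm{Symp}(\mathbb R^{2n})]_{S_\mu}=[Z^2(\mathbb R^{2n})]_{S_\mu}$. 4. If $n=2$, then $[\mathrm{Symp}(\mathbb R^{4})]_{S_\mu}$ is the set of the algebraic restrictions $[c_1\theta_1+\dots+c_\mu\theta_\mu]_{S_\mu}$ with $c_1,\dots,c_\mu\in\mathbb R$ and $(c_1,c_2,c_3)\ne(0,0,0)$, and it is open in the $\mu$-dimensional space $[Z^2(\mathbb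 R^{4})]_{S_\mu}$ (in the coordinates $c_1,\dots,c_\mu$). -/

import Mathlib

noncomputable section

namespace AlgRestr

section General

open Filter Topology
open scoped ContDiff

variable (E : Type*) [NormedAddCommGroup E] [NormedSpace ℝ E]

/-- Germs at `0` of arbitrary (not necessarily smooth) differential `p`-forms on `E`. -/
def AnyGerm (p : ℕ) : Type _ := Germ (𝓝 (0 : E)) (E [⋀^Fin p]→L[ℝ] ℝ)

instance (p : ℕ) : AddCommGroup (AnyGerm E p) :=
  inferInstanceAs (AddCommGroup (Germ (𝓝 (0 : E)) (E [⋀^Fin p]→L[ℝ] ℝ)))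

instance (p : ℕ) : Module ℝ (AnyGerm E p) :=
  inferInstanceAs (Module ℝ (Germ (𝓝 (0 : E)) (E [⋀^Fin p]→L[ℝ] ℝ)))

variable {E} in
/-- The germ at `0` of a differential form. -/
def germ {p : ℕ} (f : E → E [⋀^Fin p]→L[ℝ] ℝ) : AnyGerm E p := Germ.ofFun f

/-- `Λ^p(E)`: the vector space of germs at `0` of smooth differential `p`-forms on `E`. A germ
belongs to it if it has a representative that is `C^∞` on a neighbourhood of `0`. -/
def FormGerm (p : ℕ) : Submodule ℝ (AnyGerm E p) where
  carrier := {g | ∃ f : E → E [⋀^Fin p]→L[ℝ] ℝ,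
    (∀ᶠ x in 𝓝 (0 : E), ContDiffAt ℝ ∞ f x) ∧ germ f = g}
  zero_mem' := ⟨fun _ => 0, Eventually.of_forall fun _ => contDiffAt_const, rfl⟩
  add_mem' := by
    rintro _ _ ⟨f, hf, rfl⟩ ⟨g, hg, rfl⟩
    exact ⟨f + g, by filter_upwards [hf, hg] with x h1 h2 using h1.add h2, rfl⟩
  smul_mem' := by
    rintro c _ ⟨f, hf, rfl⟩
    exact ⟨c • f, by filter_upwards [hf] with x h1 using contDiffAt_const.smul h1, rfl⟩

variable {E}

/-- The germ at `0` of a form that is smooth near `0`. -/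
def FormGerm.mk {p : ℕ} (f : E → E [⋀^Fin p]→L[ℝ] ℝ)
    (hf : ∀ᶠ x in 𝓝 (0 : E), ContDiffAt ℝ ∞ f x) : FormGerm E p :=
  ⟨germ f, f, hf, rfl⟩

theorem contDiffAt_extDeriv {p : ℕ} {f : E → E [⋀^Fin p]→L[ℝ] ℝ} {x : E}
    (h : ContDiffAt ℝ ∞ f x) : ContDiffAt ℝ ∞ (extDeriv f) x :=
  ContDiffAt.comp (g := ContinuousAlternatingMap.alternatizeUncurryFinCLM ℝ E ℝ (n := p))
    (f := fderiv ℝ f) x (ContinuousLinearMap.contDiff _).contDiffAt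
    (h.fderiv_right (m := ∞) (by simp))

/-- The exterior derivative of germs of forms. -/
def d (p : ℕ) : FormGerm E p →ₗ[ℝ] FormGerm E (p + 1) where
  toFun g := ⟨Germ.map' extDeriv (fun _ _ h => Filter.EventuallyEq.extDeriv h) g.1, by
    obtain ⟨_, f, hf, rfl⟩ := g
    exact ⟨extDeriv f, by filter_upwards [hf] with x hx using contDiffAt_extDeriv hx, rfl⟩⟩
  map_add' := by
    rintro ⟨_, f, hf, rfl⟩ ⟨_, g, hg, rfl⟩
    refine Subtype.ext (Germ.coe_eq.2 ?_)
    filter_upwards [hf, hg] with x h1 h2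
    exact extDeriv_add (h1.differentiableAt (by simp)) (h2.differentiableAt (by simp))
  map_smul' := by
    rintro c ⟨_, f, hf, rfl⟩
    refine Subtype.ext (Germ.coe_eq.2 ?_)
    exact Eventually.of_forall fun x => extDeriv_smul c f

/-- `Λ^p_N(E)`: the germs of smooth `p`-forms `ω` with `ω(x) = 0` (all coefficients vanish) at every
point `x` of the germ at `0` of the set `N`. -/
def vanishing (N : Set E) (p : ℕ) : Submodule ℝ (FormGerm E p) where
  carrier := {g | ∃ f : E → E [⋀^Fin p]→L[ℝ] ℝ,
    germ f = g.1 ∧ ∀ᶠ x in 𝓝 (0 : E), x ∈ N → f x = 0}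
  zero_mem' := ⟨fun _ => 0, rfl, Eventually.of_forall fun _ _ => rfl⟩
  add_mem' := by
    rintro a b ⟨f, hf, hf'⟩ ⟨g, hg, hg'⟩
    refine ⟨f + g, ?_, ?_⟩
    · change germ f + germ g = _; rw [hf, hg]; rfl
    · filter_upwards [hf', hg'] with x h1 h2 hx
      simp [h1 hx, h2 hx]
  smul_mem' := by
    rintro c a ⟨f, hf, hf'⟩
    refine ⟨c • f, ?_, ?_⟩
    · change c • germ f = _; rw [hf]; rfl
    · filter_upwards [hf'] with x h1 hx
      simp [h1 hx]

/-- `A_0^2(N, E)`: the germs `α + dβ` with `α ∈ Λ^2_N(E)` and `β ∈ Λ^1_N(E)`, that is, the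
germs of `2`-forms with zero algebraic restriction to `N`. -/
def zeroRestr (N : Set E) : Submodule ℝ (FormGerm E 2) :=
  vanishing N 2 ⊔ (vanishing N 1).map (d 1)

/-- `[Λ^2(E)]_N`: the vector space of the algebraic restrictions to the germ at `0` of `N` of germs
of smooth `2`-forms. -/
abbrev Restr (N : Set E) : Type _ := FormGerm E 2 ⧸ zeroRestr N

/-- `[ω]_N`: the algebraic restriction of a germ of a `2`-form `ω` to `N`. -/
def restr (N : Set E) : FormGerm E 2 →ₗ[ℝ] Restr N := (zeroRestr N).mkQ

/-- `[Z^2(E)]_N`: the algebraic restrictions to `N` of germs of closed `2`-forms. -/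
def closedRestr (N : Set E) : Submodule ℝ (Restr N) := (LinearMap.ker (d (E := E) 2)).map (restr N)

/-- Nondegeneracy of an alternating bilinear form. -/
def Nondeg (b : E [⋀^Fin 2]→L[ℝ] ℝ) : Prop := ∀ v : E, (∀ w : E, b ![v, w] = 0) → v = 0

/-- Germs at `0` of symplectic forms: closed and nondegenerate at all points near `0`. -/
def IsSymplectic (w : FormGerm E 2) : Prop := d 2 w = 0 ∧ Germ.LiftPred Nondeg w.1

/-- `[Symp(E)]_N`: the algebraic restrictions to `N` of germs of symplectic forms. -/
def sympRestr (N : Set E) : Set (Restr N) := restr N '' {w | IsSymplectic w}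

/-- The wedge product `a ∧ b` of two covectors. -/
def wedge (a b : E →L[ℝ] ℝ) : E [⋀^Fin 2]→L[ℝ] ℝ :=
  ContinuousMultilinearMap.alternatization
    ((ContinuousMultilinearMap.mkPiAlgebra ℝ (Fin 2) ℝ).compContinuousLinearMap ![a, b])

theorem wedge_apply (a b : E →L[ℝ] ℝ) (v : Fin 2 → E) :
    wedge a b v = a (v 0) * b (v 1) - a (v 1) * b (v 0) := by
  rw [wedge, ContinuousMultilinearMap.alternatization_apply_apply]
  have h : (Finset.univ : Finset (Equiv.Perm (Fin 2))) = {1, Equiv.swap 0 1} := by decide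
  rw [h, Finset.sum_pair (by decide)]
  simp [Fin.prod_univ_two]
  ring

end General

section Smu

open Filter

variable {n : ℕ} (hn : 2 ≤ n)

/-- The coordinate functions on `ℝ^{2n}`; `x hn 0`, `x hn 1`, `x hn 2` are the coordinates written
`x_1`, `x_2`, `x_3` in the text. -/
def x (i : Fin 3) : (Fin (2 * n) → ℝ) →L[ℝ] ℝ :=
  ContinuousLinearMap.proj (Fin.castLE (by omega) i)

/-- The curve `x_1^2 - x_2^2 - x_3^{μ-3} = x_2 x_3 = 0`, `x_i = 0` for `i ≥ 4`, in `ℝ^{2n}`. -/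
def S (μ : ℕ) : Set (Fin (2 * n) → ℝ) :=
  {y | x hn 0 y ^ 2 - x hn 1 y ^ 2 - x hn 2 y ^ (μ - 3) = 0 ∧ x hn 1 y * x hn 2 y = 0 ∧
    ∀ i : Fin (2 * n), 3 ≤ i.val → y i = 0}

/-- The germ at `0` of the form `x_l^k dx_i ∧ dx_j` (with indices shifted by one as for `x`). -/
def monoForm (l : Fin 3) (k : ℕ) (i j : Fin 3) : FormGerm (Fin (2 * n) → ℝ) 2 :=
  FormGerm.mk (fun y => x hn l y ^ k • wedge (x hn i) (x hn j))
    (Eventually.of_forall fun _ =>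
      (((x hn l).contDiff.pow k).smul contDiff_const).contDiffAt)

/-- `dx_i ∧ dx_j` (with indices shifted by one as for `x`). -/
def constForm (i j : Fin 3) : FormGerm (Fin (2 * n) → ℝ) 2 :=
  FormGerm.mk (fun _ => wedge (x hn i) (x hn j)) (Eventually.of_forall fun _ => contDiffAt_const)

/-- `σ_1 = x_3 dx_1 ∧ dx_2`. -/
def σ₁ : FormGerm (Fin (2 * n) → ℝ) 2 := monoForm hn 2 1 0 1

/-- `σ_2 = x_1 dx_2 ∧ dx_3`. -/
def σ₂ : FormGerm (Fin (2 * n) → ℝ) 2 := monoForm hn 0 1 1 2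

/-- The forms `θ_1 = dx_1 ∧ dx_3`, `θ_2 = dx_2 ∧ dx_3`, `θ_3 = dx_1 ∧ dx_2`, `θ_4 = σ_1 - σ_2` and
`θ_{4+k} = x_3^k dx_1 ∧ dx_3` for `k ≥ 1`. (The index `0` is not used.) -/
def θ : ℕ → FormGerm (Fin (2 * n) → ℝ) 2
  | 0 => 0
  | 1 => constForm hn 0 2
  | 2 => constForm hn 1 2
  | 3 => constForm hn 0 1
  | 4 => σ₁ hn - σ₂ hn
  | k + 5 => monoForm hn 2 (k + 1) 0 2

end Smu

end AlgRestr

end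

/-! Write x, y, z for `x_1, x_2, x_3`, and F = x² - y² - z^(μ-3), G = yz.

Upper bound. If g vanishes on `S`, then gα and h dg ∧ l have zero algebraic restriction
(`smul_wedge_fderiv_mem`). Taking g = x_j with j ≥ 4 removes every term outside dx, dy, dz. Taking g
= F and g = G gives a short list of relations, for instance y dx∧dz ≡ -z dx∧dy and y dx∧dy ≡
-((μ-3)/2) z^(μ-4) dx∧dz, up to smooth factors. Hadamard expansions of the coefficients then leave
only the θ_i and σ_1 (`genSpan_eq_top`).

Lower bound. `S` is a set of points, so the functions vanishing on it are controlled only through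
their jets at 0. The lines y = ±x, z = 0 and the branches x = ±√(z^(μ-3)), y = 0, z > 0 force many
Taylor coefficients to vanish, and tie the z^(μ-3) coefficient to the second y-derivative
(`SmoothNear.jets_of_vanishing`). Hence the coefficients at 0 of a 2-form ω with zero restriction
satisfy μ + 1 linear conditions: three values ω_ij(0); ∂_z^k ω_xz = 0 for 1 ≤ k ≤ μ-5; ∂_z^(μ-4)
ω_xz = ((μ-3)!/2) ∂_y ω_xy; ∂_z ω_xy = ∂_y ω_xz; ∂_x ω_yz = 0. They are independent on the
generators (`eq_zero_of_add_mem_zeroRestr`), which gives dimension μ + 1.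

Closed forms. The last two conditions show that the dx∧dy∧dz coefficient of dω at 0 depends only on
the algebraic restriction. It is 0 on each θ_i and 1 on σ_1, so a closed form has no σ_1 component
(`eq_zero_of_closed`).

Symplectic forms. Adding wedges with dx_j, j ≥ 4, does not change the restriction. For n ≥ 3 this
leaves room to make any combination nondegenerate. For n = 2 the only available covector is dx_4,
and nondegeneracy can be reached exactly when ω(0) is nonzero on the hyperplane x_4 = 0, that is,
when (c_1, c_2, c_3) ≠ 0. -/

noncomputable section
namespace AlgRestr
-- Smooth dependence on parameters, Hadamard's lemma, one-sided Taylor comparison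
section Calculus

open Filter Topology Asymptotics
open scoped ContDiff

universe u

/-- `f` is smooth on a neighbourhood of `0`. -/
def SmoothNear {E F : Type*} [NormedAddCommGroup E] [NormedSpace ℝ E] [NormedAddCommGroup F]
    [NormedSpace ℝ F] (f : E → F) : Prop :=
  ∀ᶠ x in 𝓝 (0 : E), ContDiffAt ℝ ∞ f x

/-- Differentiation under the integral gives an integral of the same kind with values in `E →L[ℝ]
F`, so induction on the order applies. `E` and `F` share a universe so that the induction hypothesis
covers this new target. -/
theorem contDiff_parametric_integral_nat {E : Type u} [NormedAddCommGroup E] [NormedSpace ℝ E]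
    [FiniteDimensional ℝ E] (n : ℕ) :
    ∀ {F : Type u} [NormedAddCommGroup F] [NormedSpace ℝ F] [CompleteSpace F] {h : E × ℝ → F},
      ContDiff ℝ ∞ h → ContDiff ℝ n fun x => ∫ t in (0 : ℝ)..1, h (x, t) := by
  have : ProperSpace E := FiniteDimensional.proper ℝ E
  have key : ∀ {F : Type u} [NormedAddCommGroup F] [NormedSpace ℝ F] [CompleteSpace F]
      {h : E × ℝ → F}, ContDiff ℝ ∞ h → ∀ x, HasFDerivAt (fun x => ∫ t in (0 : ℝ)..1, h (x, t))
        (∫ t in (0 : ℝ)..1, (fderiv ℝ h (x, t)).comp (ContinuousLinearMap.inl ℝ E ℝ)) x := by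
    intro F _ _ _ h hh x
    have hc : Continuous fun p : E × ℝ => (fderiv ℝ h p).comp (ContinuousLinearMap.inl ℝ E ℝ) :=
      (hh.continuous_fderiv (by simp)).clm_comp continuous_const
    obtain ⟨C, hC⟩ := ((isCompact_closedBall x 1).prod (isCompact_Icc (a := (0 : ℝ))
      (b := 1))).exists_bound_of_continuousOn hc.continuousOn
    refine intervalIntegral.hasFDerivAt_integral_of_dominated_of_fderiv_le
      (bound := fun _ => C) (F := fun x t => h (x, t))
      (F' := fun x t => (fderiv ℝ h (x, t)).comp (ContinuousLinearMap.inl ℝ E ℝ))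
      (Metric.ball_mem_nhds x one_pos) ?_ ?_ ?_ ?_ ?_ ?_
    · exact Eventually.of_forall fun y =>
        (hh.continuous.comp (by fun_prop : Continuous fun t : ℝ => (y, t))).aestronglyMeasurable
    · exact (hh.continuous.comp
        (by fun_prop : Continuous fun t : ℝ => (x, t))).intervalIntegrable _ _
    · exact (hc.comp (by fun_prop : Continuous fun t : ℝ => (x, t))).aestronglyMeasurable
    · refine Eventually.of_forall fun t ht y hy => ?_
      rw [Set.uIoc_of_le zero_le_one] at ht
      exact hC (y, t) ⟨Metric.ball_subset_closedBall hy, ht.1.le, ht.2⟩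
    · exact intervalIntegrable_const
    · refine Eventually.of_forall fun t _ y _ => ?_
      have h1 : HasFDerivAt h (fderiv ℝ h (y, t)) (y, t) :=
        (hh.differentiable (by simp)).differentiableAt.hasFDerivAt
      exact h1.comp y (hasFDerivAt_prodMk_left y t)
  induction n with
  | zero =>
    intro F _ _ _ h hh
    rw [Nat.cast_zero, contDiff_zero]
    exact continuous_iff_continuousAt.2 fun x => (key hh x).continuousAt
  | succ n ih =>
    intro F _ _ _ h hh
    push_cast
    rw [contDiff_succ_iff_fderiv]
    refine ⟨fun x => (key hh x).differentiableAt, by simp, ?_⟩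
    rw [funext fun x => (key hh x).fderiv]
    exact ih (h := fun p => (fderiv ℝ h p).comp (ContinuousLinearMap.inl ℝ E ℝ))
      ((hh.fderiv_right (m := ∞) (by simp)).clm_comp contDiff_const)

theorem contDiff_parametric_integral {E F : Type u} [NormedAddCommGroup E] [NormedSpace ℝ E]
    [FiniteDimensional ℝ E] [NormedAddCommGroup F] [NormedSpace ℝ F] [CompleteSpace F]
    {h : E × ℝ → F} (hh : ContDiff ℝ ∞ h) :
    ContDiff ℝ ∞ fun x => ∫ t in (0 : ℝ)..1, h (x, t) :=
  contDiff_infty.2 fun n => contDiff_parametric_integral_nat n hh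

/-- A relative form of Hadamard's lemma: the increment of a smooth function between `P y` and `y`
is a smooth linear function of `y - P y`. -/
theorem exists_contDiff_sub_eq {E F : Type u} [NormedAddCommGroup E] [NormedSpace ℝ E]
    [FiniteDimensional ℝ E] [NormedAddCommGroup F] [NormedSpace ℝ F] [CompleteSpace F]
    {f : E → F} (hf : ContDiff ℝ ∞ f) (P : E →L[ℝ] E) :
    ∃ G : E → E →L[ℝ] F, ContDiff ℝ ∞ G ∧ ∀ y, f y - f (P y) = G y (y - P y) := by
  have hG : ContDiff ℝ ∞ fun p : E × ℝ => fderiv ℝ f (P p.1 + p.2 • (p.1 - P p.1)) :=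
    (hf.fderiv_right (m := ∞) (by simp)).comp (by fun_prop)
  -- `G y` is the average of the derivative over the segment from `P y` to `y`.
  refine ⟨fun y => ∫ t in (0 : ℝ)..1, fderiv ℝ f (P y + t • (y - P y)),
    contDiff_parametric_integral hG, fun y => ?_⟩
  have hc : Continuous fun t : ℝ => fderiv ℝ f (P y + t • (y - P y)) :=
    hG.continuous.comp (by fun_prop : Continuous fun t : ℝ => (y, t))
  rw [ContinuousLinearMap.intervalIntegral_apply (hc.intervalIntegrable _ _)]
  have hd : ∀ t ∈ Set.uIcc (0 : ℝ) 1, HasDerivAt (fun t : ℝ => f (P y + t • (y - P y)))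
      (fderiv ℝ f (P y + t • (y - P y)) (y - P y)) t := by
    intro t _
    have h1 : HasDerivAt (fun t : ℝ => P y + t • (y - P y)) (y - P y) t := by
      simpa using ((hasDerivAt_id t).smul_const (y - P y)).const_add (P y)
    exact ((hf.differentiable (by simp)).differentiableAt.hasFDerivAt).comp_hasDerivAt t h1
  rw [intervalIntegral.integral_eq_sub_of_hasDerivAt hd
    ((hc.clm_apply continuous_const).intervalIntegrable _ _)]
  simp

/-- Multiplication by a bump function supported where `f` is smooth. -/
theorem SmoothNear.exists_contDiff_eventuallyEq {E F : Type*} [NormedAddCommGroup E]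
    [NormedSpace ℝ E] [FiniteDimensional ℝ E] [NormedAddCommGroup F] [NormedSpace ℝ F]
    {f : E → F} (hf : SmoothNear f) : ∃ g : E → F, ContDiff ℝ ∞ g ∧ g =ᶠ[𝓝 0] f := by
  obtain ⟨b, hb⟩ : ∃ b : ContDiffBump (0 : E), tsupport b ⊆ {x | ContDiffAt ℝ ∞ f x} := by
    obtain ⟨r, hr, hr'⟩ := Metric.eventually_nhds_iff_ball.1 hf
    refine ⟨⟨r / 4, r / 2, by positivity, by linarith⟩, ?_⟩
    rw [ContDiffBump.tsupport_eq]
    exact (Metric.closedBall_subset_ball (by dsimp; linarith)).trans hr'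
  refine ⟨fun x => b x • f x, ?_, ?_⟩
  · refine contDiff_iff_contDiffAt.2 fun x => ?_
    by_cases hx : x ∈ tsupport b
    · exact b.contDiffAt.smul (hb hx)
    · have : (fun x => b x • f x) =ᶠ[𝓝 x] fun _ => 0 := by
        filter_upwards [notMem_tsupport_iff_eventuallyEq.1 hx] with y hy
        simp [hy]
      exact contDiffAt_const.congr_of_eventuallyEq this
  · filter_upwards [b.eventuallyEq_one] with x hx
    simp [hx]

theorem _root_.ContDiff.smoothNear {E F : Type*} [NormedAddCommGroup E]
    [NormedSpace ℝ E] [NormedAddCommGroup F] [NormedSpace ℝ F]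
    {f : E → F} (hf : ContDiff ℝ ∞ f) : SmoothNear f :=
  Eventually.of_forall fun _ => hf.contDiffAt

theorem SmoothNear.exists_sub_eq {E F : Type u} [NormedAddCommGroup E] [NormedSpace ℝ E]
    [FiniteDimensional ℝ E] [NormedAddCommGroup F] [NormedSpace ℝ F] [CompleteSpace F]
    {f : E → F} (hf : SmoothNear f) (P : E →L[ℝ] E) :
    ∃ G : E → E →L[ℝ] F, ContDiff ℝ ∞ G ∧ ∀ᶠ y in 𝓝 0, f y - f (P y) = G y (y - P y) := by
  obtain ⟨g, hg, hgf⟩ := hf.exists_contDiff_eventuallyEq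
  obtain ⟨G, hG, hG'⟩ := exists_contDiff_sub_eq hg P
  refine ⟨G, hG, ?_⟩
  have hP : Tendsto P (𝓝 0) (𝓝 0) := by simpa using P.continuous.tendsto 0
  filter_upwards [hgf, hP.eventually hgf] with y h1 h2
  rw [← h1, ← h2, hG']

theorem eq_zero_of_sum_isLittleO (m : ℕ) (a : ℕ → ℝ)
    (h : (fun s : ℝ => ∑ i ∈ Finset.range (m + 1), a i * s ^ i) =o[𝓝[>] 0] fun s => s ^ m) :
    ∀ i ≤ m, a i = 0 := by
  induction m generalizing a with
  | zero =>
    intro i hi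
    obtain rfl : i = 0 := by omega
    simpa [isLittleO_const_const_iff] using h
  | succ m ih =>
    have h0 : a 0 = 0 := by
      have h1 : Tendsto (fun s : ℝ => ∑ i ∈ Finset.range (m + 1 + 1), a i * s ^ i) (𝓝[>] 0)
          (𝓝 (∑ i ∈ Finset.range (m + 1 + 1), a i * 0 ^ i)) :=
        (Continuous.tendsto (by fun_prop) 0).mono_left nhdsWithin_le_nhds
      have h2 : Tendsto (fun s : ℝ => s ^ (m + 1)) (𝓝[>] 0) (𝓝 (0 ^ (m + 1))) :=
        (Continuous.tendsto (by fun_prop) 0).mono_left nhdsWithin_le_nhds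
      rw [zero_pow (by simp)] at h2
      have h3 := tendsto_nhds_unique h1 (h.trans_tendsto h2)
      rwa [Finset.sum_range_succ', Finset.sum_eq_zero (by simp), zero_add, pow_zero, mul_one] at h3
    have h4 := ih (fun i => a (i + 1)) ?_
    · rintro (_ | i) hi
      · exact h0
      · exact h4 i (by omega)
    · rw [isLittleO_iff] at h ⊢
      intro c hc
      filter_upwards [h hc, self_mem_nhdsWithin] with s hs hs0
      have hs0 : 0 < s := hs0
      rw [Finset.sum_range_succ', h0, zero_mul, add_zero] at hs
      have : ∑ i ∈ Finset.range (m + 1), a (i + 1) * s ^ (i + 1)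
          = s * ∑ i ∈ Finset.range (m + 1), a (i + 1) * s ^ i := by
        rw [Finset.mul_sum]
        exact Finset.sum_congr rfl fun i _ => by ring
      rw [this, norm_mul, pow_succ', norm_mul, mul_left_comm] at hs
      exact le_of_mul_le_mul_left hs (norm_pos_iff.2 hs0.ne')

/-- The Taylor polynomial of `φ` differs from L s^m by o(s^m), hence equals it. The filter is
one-sided because for odd μ - 3 the curve has real points only over z ≥ 0. -/
theorem SmoothNear.iteratedDeriv_of_isLittleO {φ : ℝ → ℝ} (hφ : SmoothNear φ) {m : ℕ} {L : ℝ}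
    (h : (fun s => φ s - L * s ^ m) =o[𝓝[>] 0] fun s => s ^ m) :
    (∀ j < m, iteratedDeriv j φ 0 = 0) ∧ iteratedDeriv m φ 0 = m.factorial * L := by
  obtain ⟨g, hg, hgf⟩ := hφ.exists_contDiff_eventuallyEq
  have h1 : (fun s => g s - L * s ^ m) =o[𝓝[>] 0] fun s => s ^ m :=
    h.congr' (by filter_upwards [hgf.filter_mono nhdsWithin_le_nhds] with s hs; rw [hs]) .rfl
  have h2 := (taylor_isLittleO_univ (x₀ := 0) (n := m) (hg.of_le (by exact_mod_cast le_top))).mono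
    (nhdsWithin_le_nhds (s := Set.Ioi 0))
  simp only [sub_zero] at h2
  have h3 := eq_zero_of_sum_isLittleO m
    (fun i => (i.factorial : ℝ)⁻¹ * iteratedDeriv i g 0 - if i = m then L else 0) ?_
  · have h4 : ∀ j, iteratedDeriv j φ 0 = iteratedDeriv j g 0 := fun j =>
      (hgf.symm.iteratedDeriv_eq j)
    constructor
    · intro j hj
      have := h3 j hj.le
      rw [if_neg hj.ne, sub_zero] at this
      rw [h4]
      exact (mul_eq_zero.1 this).resolve_left (by positivity)
    · have := h3 m le_rfl
      rw [if_pos rfl] at this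
      rw [h4, ← sub_eq_zero.1 this, mul_inv_cancel_left₀ (by positivity)]
  · refine (h1.sub h2).congr_left fun s => ?_
    simp only [taylor_within_apply, sub_zero, iteratedDerivWithin_univ, smul_eq_mul, sub_mul,
      Finset.sum_sub_distrib, ite_mul, zero_mul]
    rw [Finset.sum_ite_eq_of_mem' _ _ _ (by simp)]
    have : ∑ i ∈ Finset.range (m + 1), (i.factorial : ℝ)⁻¹ * s ^ i * iteratedDeriv i g 0
        = ∑ i ∈ Finset.range (m + 1), (i.factorial : ℝ)⁻¹ * iteratedDeriv i g 0 * s ^ i :=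
      Finset.sum_congr rfl fun i _ => by ring
    rw [this]
    ring

end Calculus

/-! ### Jets along lines -/

section Jets

open Filter Topology Asymptotics
open scoped ContDiff

variable {E F : Type*} [NormedAddCommGroup E] [NormedSpace ℝ E] [NormedAddCommGroup F]
  [NormedSpace ℝ F]

theorem tendsto_smul_nhds_zero (v : E) : Tendsto (fun s : ℝ => s • v) (𝓝 0) (𝓝 0) :=
  (Continuous.tendsto' (by fun_prop) 0 0 (by simp))

theorem SmoothNear.contDiffAt {f : E → F} (hf : SmoothNear f) : ContDiffAt ℝ ∞ f 0 :=
  hf.self_of_nhds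

theorem SmoothNear.comp_smul {f : E → F} (hf : SmoothNear f) (v : E) :
    SmoothNear fun s : ℝ => f (s • v) := by
  filter_upwards [(tendsto_smul_nhds_zero v).eventually hf] with s hs
  exact hs.comp s (by fun_prop)

theorem SmoothNear.smoothNear_fderiv {f : E → F} (hf : SmoothNear f) : SmoothNear (fderiv ℝ f) :=
  hf.mono fun _ hx => hx.fderiv_right (m := ∞) (by simp)

theorem SmoothNear.clm_apply {f : E → E →L[ℝ] F} (hf : SmoothNear f) (v : E) :
    SmoothNear fun y => f y v :=
  hf.mono fun _ hx => hx.clm_apply contDiffAt_const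

/-- The second derivative of `f` at `0`. -/
def hess (f : E → F) : E →L[ℝ] E →L[ℝ] F := fderiv ℝ (fderiv ℝ f) 0

theorem SmoothNear.hess_comm {f : E → F} (hf : SmoothNear f) (v w : E) :
    hess f v w = hess f w v :=
  (hf.contDiffAt.isSymmSndFDerivAt (by simpa using ENat.LEInfty.out)) v w

/-- The `k`-th derivative at `0`, along the line spanned by `v`, of the derivative of `f` in the
direction `u`. -/
def lineJet (f : E → F) (v u : E) (k : ℕ) : F :=
  iteratedDeriv k (fun s : ℝ => fderiv ℝ f (s • v) u) 0

theorem lineJet_zero (f : E → F) (v u : E) : lineJet f v u 0 = fderiv ℝ f 0 u := by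
  simp [lineJet]

theorem SmoothNear.lineJet_one {f : E → F} (hf : SmoothNear f) (v u : E) :
    lineJet f v u 1 = hess f v u := by
  have h1 : HasFDerivAt (fun y => fderiv ℝ f y u) ((hess f).flip u) ((0 : ℝ) • v) := by
    rw [zero_smul]
    have := (hf.smoothNear_fderiv.contDiffAt.differentiableAt (by simp)).hasFDerivAt
    simpa using! this.clm_apply (hasFDerivAt_const u _)
  have h2 : HasDerivAt (fun s : ℝ => s • v) v 0 := by
    simpa using (hasDerivAt_id (0 : ℝ)).smul_const v
  rw [lineJet, iteratedDeriv_one]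
  exact (h1.comp_hasDerivAt (0 : ℝ) h2).deriv

theorem SmoothNear.lineJet_self {f : E → F} (hf : SmoothNear f) (v : E) (k : ℕ) :
    lineJet f v v k = iteratedDeriv (k + 1) (fun s : ℝ => f (s • v)) 0 := by
  rw [iteratedDeriv_succ', lineJet]
  refine Filter.EventuallyEq.iteratedDeriv_eq k ?_
  filter_upwards [(tendsto_smul_nhds_zero v).eventually hf] with s hs
  have h2 : HasDerivAt (fun s : ℝ => s • v) v s := by
    simpa using (hasDerivAt_id s).smul_const v
  exact ((hs.differentiableAt (by simp)).hasFDerivAt.comp_hasDerivAt s h2).deriv.symm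

theorem iteratedDeriv_eq_zero_of_eventually {φ : ℝ → F} (h : ∀ᶠ s in 𝓝 0, φ s = 0) (k : ℕ) :
    iteratedDeriv k φ 0 = 0 := by
  rw [Filter.EventuallyEq.iteratedDeriv_eq (g := fun _ => 0) k h]
  simp

end Jets

/-! ### Jets of functions vanishing on the curve -/

section Curve

open Filter Topology Asymptotics
open scoped ContDiff

variable {n : ℕ} (hn : 2 ≤ n)

/-- The coordinate vectors dual to `x hn i`. -/
def e (i : Fin 3) : Fin (2 * n) → ℝ := Pi.single (Fin.castLE (by omega) i) 1

theorem x_e (i j : Fin 3) : x hn i (e hn j) = if i = j then 1 else 0 := by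
  simp [x, e, Pi.single_apply, Fin.ext_iff]

theorem e_apply_of_le (i : Fin 3) {j : Fin (2 * n)} (hj : 3 ≤ j.val) : e hn i j = 0 := by
  simp only [e, Pi.single_apply, Fin.ext_iff, Fin.val_castLE]
  rw [if_neg (by omega)]

theorem mem_S (μ : ℕ) (a b c : ℝ) :
    a • e hn 0 + b • e hn 1 + c • e hn 2 ∈ S hn μ ↔
      a ^ 2 - b ^ 2 - c ^ (μ - 3) = 0 ∧ b * c = 0 := by
  simp only [S, Set.mem_ofPred_eq, map_add, map_smul, x_e]
  have : ∀ i : Fin (2 * n), 3 ≤ i.val → (a • e hn 0 + b • e hn 1 + c • e hn 2) i = 0 := by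
    intro i hi
    simp [e_apply_of_le hn _ hi]
  simp only [Fin.isValue, smul_eq_mul]
  simpa using fun _ _ => by simpa using this

variable {hn} {μ : ℕ} {f : (Fin (2 * n) → ℝ) → ℝ}

/-- The two lines y = ±x, z = 0 are components of `S`. -/
theorem eventually_line_eq_zero (hv : ∀ᶠ y in 𝓝 0, y ∈ S hn μ → f y = 0) (hμ : 5 < μ) (b : ℝ)
    (hb : b ^ 2 = 1) : ∀ᶠ s : ℝ in 𝓝 0, f (s • (e hn 0 + b • e hn 1)) = 0 := by
  filter_upwards [(tendsto_smul_nhds_zero (e hn 0 + b • e hn 1)).eventually hv] with s hs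
  apply hs
  have := mem_S hn μ s (s * b) 0
  rw [zero_smul, add_zero, mul_smul, ← smul_add] at this
  rw [this]
  simp [mul_pow, hb, zero_pow (show μ - 3 ≠ 0 by omega)]

theorem SmoothNear.apply_zero_of_vanishing (hv : ∀ᶠ y in 𝓝 0, y ∈ S hn μ → f y = 0)
    (hμ : 5 < μ) : f 0 = 0 := by
  simpa using (eventually_line_eq_zero hv hμ 1 (by simp)).self_of_nhds

theorem SmoothNear.fderiv_of_vanishing (hf : SmoothNear f)
    (hv : ∀ᶠ y in 𝓝 0, y ∈ S hn μ → f y = 0) (hμ : 5 < μ) :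
    fderiv ℝ f 0 (e hn 0) = 0 ∧ fderiv ℝ f 0 (e hn 1) = 0 := by
  have key : ∀ b : ℝ, b ^ 2 = 1 → fderiv ℝ f 0 (e hn 0) + b * fderiv ℝ f 0 (e hn 1) = 0 := by
    intro b hb
    have h1 := iteratedDeriv_eq_zero_of_eventually (eventually_line_eq_zero hv hμ b hb) 1
    rw [← hf.lineJet_self _ 0, lineJet_zero] at h1
    simpa using h1
  have h1 := key 1 (by norm_num)
  have h2 := key (-1) (by norm_num)
  constructor <;> linarith

theorem SmoothNear.hess_of_vanishing (hf : SmoothNear f)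
    (hv : ∀ᶠ y in 𝓝 0, y ∈ S hn μ → f y = 0) (hμ : 5 < μ) :
    hess f (e hn 0) (e hn 1) = 0 ∧
      hess f (e hn 0) (e hn 0) = - hess f (e hn 1) (e hn 1) := by
  -- The Hessian, as a quadratic form, vanishes on `e 0 ± e 1`; the sum and difference of the two
  -- equations give the claims.
  have key : ∀ b : ℝ, b ^ 2 = 1 → hess f (e hn 0) (e hn 0) + 2 * b * hess f (e hn 0) (e hn 1)
      + hess f (e hn 1) (e hn 1) = 0 := by
    intro b hb
    have h1 := iteratedDeriv_eq_zero_of_eventually (eventually_line_eq_zero hv hμ b hb) 2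
    rw [← hf.lineJet_self _ 1, hf.lineJet_one] at h1
    simp only [map_add, map_smul, add_apply, smul_apply,
      smul_eq_mul, hf.hess_comm (e hn 1) (e hn 0)] at h1
    linear_combination h1 - hess f (e hn 1) (e hn 1) * hb
  have h1 := key 1 (by norm_num)
  have h2 := key (-1) (by norm_num)
  constructor <;> linarith

/-- The second order expansion of a smooth function along the first coordinate. -/
theorem SmoothNear.exists_expansion (hn : 2 ≤ n) (hf : SmoothNear f) :
    ∃ g₁ g₂ : (Fin (2 * n) → ℝ) → ℝ, ContDiff ℝ ∞ g₁ ∧ ContDiff ℝ ∞ g₂ ∧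
      (∀ᶠ p : ℝ × ℝ in 𝓝 0, f (p.1 • e hn 0 + p.2 • e hn 2) =
        f (p.2 • e hn 2) + p.1 * g₁ (p.2 • e hn 2)
          + p.1 ^ 2 * g₂ (p.1 • e hn 0 + p.2 • e hn 2)) := by
  set P : (Fin (2 * n) → ℝ) →L[ℝ] (Fin (2 * n) → ℝ) :=
    ContinuousLinearMap.id ℝ _ - (x hn 0).smulRight (e hn 0) with hP
  have hPe : ∀ a s : ℝ, P (a • e hn 0 + s • e hn 2) = s • e hn 2 := by
    intro a s
    simp [hP, x_e]
  obtain ⟨G, hG, hG'⟩ := hf.exists_sub_eq P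
  have hg : ContDiff ℝ ∞ fun y => G y (e hn 0) := hG.clm_apply contDiff_const
  obtain ⟨K, hK, hK'⟩ := exists_contDiff_sub_eq hg P
  refine ⟨fun y => G y (e hn 0), fun y => K y (e hn 0), hg, hK.clm_apply contDiff_const, ?_⟩
  have ht : Tendsto (fun p : ℝ × ℝ => p.1 • e hn 0 + p.2 • e hn 2) (𝓝 0) (𝓝 0) :=
    Continuous.tendsto' (by fun_prop) 0 0 (by simp)
  filter_upwards [ht.eventually hG'] with p hp
  have h2 := hK' (p.1 • e hn 0 + p.2 • e hn 2)
  rw [hPe, add_sub_cancel_right, map_smul, smul_eq_mul] at hp h2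
  linear_combination hp + p.1 * h2

/-- Write f(x,0,z) = f(0,0,z) + x g₁(z) + x² g₂(x,z) and evaluate on the two branches x =
±√(z^(μ-3)). The half-sum gives f(0,0,z) = -g₂(0) z^(μ-3) + o(z^(μ-3)), the half-difference g₁(z) =
O(z^(μ-3)). Moreover 2 g₂(0) = f_xx(0) = -f_yy(0), the last equality coming from the lines y = ±x.
-/
theorem SmoothNear.jets_of_vanishing (hf : SmoothNear f)
    (hv : ∀ᶠ y in 𝓝 0, y ∈ S hn μ → f y = 0) (hμ : 5 < μ) :
    (∀ j < μ - 3, lineJet f (e hn 2) (e hn 0) j = 0) ∧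
    (∀ j < μ - 3, iteratedDeriv j (fun s : ℝ => f (s • e hn 2)) 0 = 0) ∧
    iteratedDeriv (μ - 3) (fun s : ℝ => f (s • e hn 2)) 0 =
      (μ - 3).factorial / 2 * hess f (e hn 1) (e hn 1) := by
  obtain ⟨g₁, g₂, hg₁, hg₂, hexp⟩ := hf.exists_expansion hn
  obtain ⟨m, hm⟩ : ∃ m, μ = m + 4 := ⟨μ - 4, by omega⟩
  have hm' : μ - 3 = m + 1 := by omega
  -- On the z-axis g₁ is the x-derivative of `f`.
  have hfd : ∀ᶠ s : ℝ in 𝓝 0, fderiv ℝ f (s • e hn 2) (e hn 0) = g₁ (s • e hn 2) := by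
    have ht : Tendsto (fun s : ℝ => ((0, s) : ℝ × ℝ)) (𝓝 0) (𝓝 0) :=
      Continuous.tendsto' (by fun_prop) 0 0 rfl
    filter_upwards [ht.eventually hexp.eventually_nhds,
      (tendsto_smul_nhds_zero (e hn 2)).eventually hf] with s hs hfs
    have ht2 : Tendsto (fun a : ℝ => ((a, s) : ℝ × ℝ)) (𝓝 0) (𝓝 (0, s)) :=
      Continuous.tendsto' (by fun_prop) 0 _ rfl
    have h1 : HasDerivAt (fun a : ℝ => a • e hn 0 + s • e hn 2) (e hn 0) 0 := by
      simpa using ((hasDerivAt_id (0 : ℝ)).smul_const (e hn 0)).add_const (s • e hn 2)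
    have h2 : HasDerivAt (fun a : ℝ => f (a • e hn 0 + s • e hn 2))
        (fderiv ℝ f (s • e hn 2) (e hn 0)) 0 := by
      refine HasFDerivAt.comp_hasDerivAt (0 : ℝ) ?_ h1
      simpa using (hfs.differentiableAt (by simp)).hasFDerivAt
    have h3 : HasDerivAt (fun a : ℝ => g₂ (a • e hn 0 + s • e hn 2))
        (fderiv ℝ g₂ ((0 : ℝ) • e hn 0 + s • e hn 2) (e hn 0)) 0 :=
      ((hg₂.differentiable (by simp)).differentiableAt.hasFDerivAt).comp_hasDerivAt (0 : ℝ) h1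
    have h4 := (((hasDerivAt_id (0 : ℝ)).mul_const (g₁ (s • e hn 2))).const_add
      (f (s • e hn 2))).add (((hasDerivAt_id (0 : ℝ)).pow 2).mul h3)
    have h5 := h2.unique (h4.congr_of_eventuallyEq (ht2.eventually hs))
    simpa using h5
  have hfd0 := hfd.self_of_nhds
  rw [zero_smul, (hf.fderiv_of_vanishing hv hμ).1] at hfd0
  have hf0 := SmoothNear.apply_zero_of_vanishing hv hμ
  have hxx : hess f (e hn 0) (e hn 0) = 2 * g₂ 0 := by
    have h1 : (fun s : ℝ => f (s • e hn 0) - g₂ 0 * s ^ 2) =o[𝓝[>] 0] fun s => s ^ 2 := by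
      have h2 : (fun s : ℝ => g₂ (s • e hn 0) - g₂ 0) =o[𝓝[>] 0] fun _ => (1 : ℝ) := by
        rw [isLittleO_one_iff, tendsto_sub_nhds_zero_iff]
        exact ((hg₂.continuous.tendsto 0).comp (tendsto_smul_nhds_zero _)).mono_left
          nhdsWithin_le_nhds
      refine (h2.mul_isBigO (isBigO_refl (fun s : ℝ => s ^ 2) _)).congr' ?_ (by simp)
      have ht : Tendsto (fun s : ℝ => ((s, 0) : ℝ × ℝ)) (𝓝[>] 0) (𝓝 0) :=
        (Continuous.tendsto' (by fun_prop) (0 : ℝ) 0 rfl).mono_left nhdsWithin_le_nhds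
      filter_upwards [ht.eventually hexp] with s hs
      simp only [zero_smul, add_zero, hf0, ← hfd0] at hs
      rw [hs]
      ring
    have h2 := ((hf.comp_smul (e hn 0)).iteratedDeriv_of_isLittleO h1).2
    rw [← hf.lineJet_self _ 1, hf.lineJet_one] at h2
    simpa using h2
  -- points of the curve on the plane of the first and third coordinates
  have hpt : Tendsto (fun s : ℝ => √(s ^ (m + 1))) (𝓝[>] 0) (𝓝 0) :=
    (Continuous.tendsto' (by fun_prop) 0 0 (by simp)).mono_left nhdsWithin_le_nhds
  have hsz : Tendsto (fun s : ℝ => s) (𝓝[>] 0) (𝓝 0) := nhdsWithin_le_nhds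
  have hpt' : ∀ b : ℝ, Tendsto (fun s : ℝ => ((b * √(s ^ (m + 1)), s) : ℝ × ℝ)) (𝓝[>] 0)
      (𝓝 0) := fun b => by
    simpa [← Prod.zero_eq_mk] using (hpt.const_mul b).prodMk_nhds hsz
  have hvec : ∀ b : ℝ, Tendsto (fun s : ℝ => (b * √(s ^ (m + 1))) • e hn 0 + s • e hn 2) (𝓝[>] 0)
      (𝓝 0) := fun b => by
    simpa using ((hpt.const_mul b).smul_const (e hn 0)).add (hsz.smul_const (e hn 2))
  -- The sign b = ±1 selects the branch.
  have hzero : ∀ b : ℝ, b ^ 2 = 1 → ∀ᶠ s : ℝ in 𝓝[>] 0,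
      f (s • e hn 2) + b * √(s ^ (m + 1)) * g₁ (s • e hn 2)
        + s ^ (m + 1) * g₂ ((b * √(s ^ (m + 1))) • e hn 0 + s • e hn 2) = 0 := by
    intro b hb
    filter_upwards [(hpt' b).eventually hexp, (hvec b).eventually hv, self_mem_nhdsWithin]
      with s h1 h2 hs
    have hs : 0 < s := hs
    have hsq : √(s ^ (m + 1)) ^ 2 = s ^ (m + 1) := Real.sq_sqrt (by positivity)
    have hS := mem_S hn μ (b * √(s ^ (m + 1))) 0 s
    rw [zero_smul, add_zero] at hS
    rw [h2 (hS.2 (by simp [mul_pow, hb, hsq, hm']))] at h1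
    rw [mul_pow, hb, hsq, one_mul] at h1
    exact h1.symm
  have hplus := hzero 1 (by norm_num)
  have hminus := hzero (-1) (by norm_num)
  rw [hm']
  have heven := (hf.comp_smul (e hn 2)).iteratedDeriv_of_isLittleO (m := m + 1) (L := - g₂ 0) ?_
  · refine ⟨?_, heven.1, ?_⟩
    · have hodd := (hg₁.smoothNear.comp_smul (e hn 2)).iteratedDeriv_of_isLittleO
        (m := m) (L := 0) ?_
      · intro j hj
        rw [lineJet, Filter.EventuallyEq.iteratedDeriv_eq j hfd]
        rcases Nat.lt_succ_iff_lt_or_eq.1 hj with h | rfl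
        · exact hodd.1 j h
        · simpa using hodd.2
      -- The two branches are 2√(s^(m+1)) apart, so the Lipschitz bound on g₂ supplies the second
      -- factor √(s^(m+1)); continuity alone would give only o(√(s^(m+1))).
      · obtain ⟨C, t, ht, hC⟩ := ((hg₂.of_le (by simp)).contDiffAt (x := 0)).exists_lipschitzOnWith
        have hO : (fun s : ℝ => g₁ (s • e hn 2)) =O[𝓝[>] 0] fun s => s ^ (m + 1) := by
          refine IsBigO.of_bound (C * ‖e hn 0‖) ?_
          filter_upwards [hplus, hminus, (hvec 1).eventually ht, (hvec (-1)).eventually ht,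
            self_mem_nhdsWithin] with s h1 h2 h3 h4 hs
          have hs : 0 < s := hs
          have hr : 0 < √(s ^ (m + 1)) := Real.sqrt_pos.2 (by positivity)
          have hsq : √(s ^ (m + 1)) * √(s ^ (m + 1)) = s ^ (m + 1) :=
            Real.mul_self_sqrt (by positivity)
          have h5 := hC.dist_le_mul _ h3 _ h4
          set r := √(s ^ (m + 1))
          rw [dist_eq_norm, dist_eq_norm, add_sub_add_right_eq_sub, ← sub_smul, norm_smul] at h5
          have h6 : ‖1 * r - -1 * r‖ = 2 * r := by
            rw [Real.norm_of_nonneg (by linarith)]; ring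
          rw [h6] at h5
          have h7 : g₁ (s • e hn 2) = -(r / 2) * (g₂ ((1 * r) • e hn 0 + s • e hn 2)
              - g₂ ((-1 * r) • e hn 0 + s • e hn 2)) := by
            have : r * (g₁ (s • e hn 2) + (r / 2) * (g₂ ((1 * r) • e hn 0 + s • e hn 2)
              - g₂ ((-1 * r) • e hn 0 + s • e hn 2))) = 0 := by
              linear_combination h1 / 2 - h2 / 2 + (g₂ ((1 * r) • e hn 0 + s • e hn 2)
                - g₂ ((-1 * r) • e hn 0 + s • e hn 2)) / 2 * hsq
            linear_combination (mul_eq_zero.1 this).resolve_left hr.ne'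
          rw [h7, norm_mul, norm_neg, Real.norm_of_nonneg (by positivity : 0 ≤ r / 2),
            Real.norm_of_nonneg (by positivity : 0 ≤ s ^ (m + 1))]
          calc r / 2 * _ ≤ r / 2 * (C * (2 * r * ‖e hn 0‖)) := by gcongr
            _ = C * ‖e hn 0‖ * s ^ (m + 1) := by rw [← hsq]; ring
        simp only [zero_mul, sub_zero]
        exact hO.trans_isLittleO ((isLittleO_pow_pow (lt_add_one m)).mono nhdsWithin_le_nhds)
    · rw [heven.2]
      have := (hf.hess_of_vanishing hv hμ).2
      rw [hxx] at this
      linear_combination (-(m + 1).factorial / 2 : ℝ) * this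
  · have hG : ∀ b : ℝ, (fun s : ℝ => g₂ ((b * √(s ^ (m + 1))) • e hn 0 + s • e hn 2) - g₂ 0)
        =o[𝓝[>] 0] fun _ => (1 : ℝ) := by
      intro b
      rw [isLittleO_one_iff, tendsto_sub_nhds_zero_iff]
      exact (hg₂.continuous.tendsto 0).comp (hvec b)
    refine ((((hG 1).add (hG (-1))).const_mul_left (-1 / 2)).mul_isBigO
      (isBigO_refl (fun s : ℝ => s ^ (m + 1)) _)).congr' ?_ (by simp)
    filter_upwards [hplus, hminus] with s h1 h2
    linear_combination -(h1 / 2) - h2 / 2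

end Curve

/-! ### Coefficient jets as linear functionals on germs -/

section Functionals

open Filter Topology
open scoped ContDiff

variable {E : Type*} [NormedAddCommGroup E] [NormedSpace ℝ E]

theorem SmoothNear.apply_const {p : ℕ} {f : E → E [⋀^Fin p]→L[ℝ] ℝ} (hf : SmoothNear f)
    (v : Fin p → E) : SmoothNear fun y => f y v :=
  hf.mono fun x hx =>
    (ContinuousAlternatingMap.apply ℝ E ℝ v).contDiff.contDiffAt.comp x hx

/-- The `k`-th derivative at `0`, along the line spanned by `v`, of the coefficient of a germ of a
`2`-form on the pair of vectors `u, w`. -/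
def coeffJet (v u w : E) (k : ℕ) : FormGerm E 2 →ₗ[ℝ] ℝ where
  toFun g := Germ.liftOn g.1 (fun f => iteratedDeriv k (fun s : ℝ => f (s • v) ![u, w]) 0) (by
    intro f g h
    refine Filter.EventuallyEq.iteratedDeriv_eq k ?_
    filter_upwards [(tendsto_smul_nhds_zero v).eventually h] with s hs
    rw [hs])
  map_add' := by
    rintro ⟨_, f, hf, rfl⟩ ⟨_, g, hg, rfl⟩
    exact iteratedDeriv_add
      (((SmoothNear.apply_const hf ![u, w]).comp_smul v).contDiffAt.of_le (mod_cast le_top))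
      (((SmoothNear.apply_const hg ![u, w]).comp_smul v).contDiffAt.of_le (mod_cast le_top))
  map_smul' := by
    rintro c ⟨_, f, hf, rfl⟩
    exact iteratedDeriv_const_smul_field c _

theorem coeffJet_mk (v u w : E) (k : ℕ) {f : E → E [⋀^Fin 2]→L[ℝ] ℝ} (hf : SmoothNear f) :
    coeffJet v u w k (FormGerm.mk f hf) =
      iteratedDeriv k (fun s : ℝ => f (s • v) ![u, w]) 0 :=
  rfl

theorem exists_rep_of_mem_vanishing {N : Set E} {p : ℕ} {a : FormGerm E p}
    (ha : a ∈ vanishing N p) : ∃ (f : E → E [⋀^Fin p]→L[ℝ] ℝ) (hf : SmoothNear f),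
      (∀ᶠ y in 𝓝 0, y ∈ N → f y = 0) ∧ a = FormGerm.mk f hf := by
  obtain ⟨f, hfa, hv⟩ := ha
  obtain ⟨_, g, hg, rfl⟩ := a
  have h : f =ᶠ[𝓝 0] g := Germ.coe_eq.1 hfa
  refine ⟨f, ?_, hv, Subtype.ext hfa.symm⟩
  filter_upwards [hg, h.eventually_nhds] with x h1 h2
  exact h1.congr_of_eventuallyEq h2

theorem mem_vanishing {N : Set E} {p : ℕ} {f : E → E [⋀^Fin p]→L[ℝ] ℝ} (hf : SmoothNear f)
    (hv : ∀ᶠ y in 𝓝 0, y ∈ N → f y = 0) : FormGerm.mk f hf ∈ vanishing N p :=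
  ⟨f, rfl, hv⟩

theorem SmoothNear.smoothNear_extDeriv {p : ℕ} {f : E → E [⋀^Fin p]→L[ℝ] ℝ} (hf : SmoothNear f) :
    SmoothNear (extDeriv f) :=
  Eventually.mono hf fun _ hx => contDiffAt_extDeriv hx

theorem d_mk {p : ℕ} {f : E → E [⋀^Fin p]→L[ℝ] ℝ} (hf : SmoothNear f) :
    d p (FormGerm.mk f hf) =
      FormGerm.mk (extDeriv f) hf.smoothNear_extDeriv :=
  rfl

theorem extDeriv_one_apply {f : E → E [⋀^Fin 1]→L[ℝ] ℝ} {y : E} (hf : DifferentiableAt ℝ f y)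
    (u w : E) : extDeriv f y ![u, w] =
      fderiv ℝ (fun y => f y ![w]) y u - fderiv ℝ (fun y => f y ![u]) y w := by
  have h0 : Fin.removeNth 0 ![u, w] = ![w] := by ext i; fin_cases i; rfl
  have h1 : Fin.removeNth 1 ![u, w] = ![u] := by ext i; fin_cases i; rfl
  rw [extDeriv_apply hf, Fin.sum_univ_two, h0, h1]
  simp [sub_eq_add_neg]

theorem coeffJet_d (v u w : E) (k : ℕ) {f : E → E [⋀^Fin 1]→L[ℝ] ℝ} (hf : SmoothNear f) :
    coeffJet v u w k (d 1 (FormGerm.mk f hf)) =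
      lineJet (fun y => f y ![w]) v u k - lineJet (fun y => f y ![u]) v w k := by
  rw [d_mk, coeffJet_mk, lineJet, lineJet, ← iteratedDeriv_fun_sub]
  · refine Filter.EventuallyEq.iteratedDeriv_eq k ?_
    filter_upwards [(tendsto_smul_nhds_zero v).eventually hf] with s hs
    exact extDeriv_one_apply (hs.differentiableAt (by simp)) u w
  · exact (((hf.apply_const ![w]).smoothNear_fderiv.clm_apply u).comp_smul v).contDiffAt.of_le
      (mod_cast le_top)
  · exact (((hf.apply_const ![u]).smoothNear_fderiv.clm_apply w).comp_smul v).contDiffAt.of_le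
      (mod_cast le_top)

/-- A linear functional vanishes on the germs with zero algebraic restriction if it does so on
forms with vanishing coefficients and on the differentials of such forms. -/
theorem eq_zero_of_mem_zeroRestr {N : Set E} (L : FormGerm E 2 →ₗ[ℝ] ℝ)
    (h2 : ∀ (f : E → E [⋀^Fin 2]→L[ℝ] ℝ) (hf : SmoothNear f),
      (∀ v, ∀ᶠ y in 𝓝 0, y ∈ N → f y v = 0) → L (FormGerm.mk f hf) = 0)
    (h1 : ∀ (f : E → E [⋀^Fin 1]→L[ℝ] ℝ) (hf : SmoothNear f),
      (∀ v, ∀ᶠ y in 𝓝 0, y ∈ N → f y v = 0) → L (d 1 (FormGerm.mk f hf)) = 0)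
    {g : FormGerm E 2} (hg : g ∈ zeroRestr N) : L g = 0 := by
  obtain ⟨a, ha, _, ⟨b, hb, rfl⟩, rfl⟩ := Submodule.mem_sup.1 hg
  obtain ⟨f, hf, hfv, rfl⟩ := exists_rep_of_mem_vanishing ha
  obtain ⟨f', hf', hfv', rfl⟩ := exists_rep_of_mem_vanishing hb
  rw [map_add, h2 f hf fun v => hfv.mono fun y hy hyN => by rw [hy hyN]; rfl,
    h1 f' hf' fun v => hfv'.mono fun y hy hyN => by rw [hy hyN]; rfl, add_zero]

end Functionals

/-! ### Linear conditions satisfied by forms with zero algebraic restriction -/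

section Obstructions

open Filter Topology
open scoped ContDiff

variable {n : ℕ} {hn : 2 ≤ n} {μ : ℕ} {f : (Fin (2 * n) → ℝ) → ℝ}

theorem SmoothNear.fderiv_e_of_vanishing (hf : SmoothNear f)
    (hv : ∀ᶠ y in 𝓝 0, y ∈ S hn μ → f y = 0) (hμ : 5 < μ) (i : Fin 3) :
    fderiv ℝ f 0 (e hn i) = 0 := by
  fin_cases i
  · exact (hf.fderiv_of_vanishing hv hμ).1
  · exact (hf.fderiv_of_vanishing hv hμ).2
  · have h := (hf.jets_of_vanishing hv hμ).2.1 1 (by omega)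
    rwa [← hf.lineJet_self _ 0, lineJet_zero] at h

theorem SmoothNear.hess_zero_two_of_vanishing (hf : SmoothNear f)
    (hv : ∀ᶠ y in 𝓝 0, y ∈ S hn μ → f y = 0) (hμ : 5 < μ) :
    hess f (e hn 2) (e hn 0) = 0 := by
  rw [← hf.lineJet_one]
  exact (hf.jets_of_vanishing hv hμ).1 1 (by omega)

theorem SmoothNear.deriv_line_of_vanishing (hf : SmoothNear f)
    (hv : ∀ᶠ y in 𝓝 0, y ∈ S hn μ → f y = 0) (hμ : 5 < μ) (i : Fin 3) :
    iteratedDeriv 1 (fun s : ℝ => f (s • e hn i)) 0 = 0 := by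
  rw [← hf.lineJet_self _ 0, lineJet_zero, hf.fderiv_e_of_vanishing hv hμ]

variable {g : FormGerm (Fin (2 * n) → ℝ) 2}

theorem coeffJet_zero_eq_zero (hg : g ∈ zeroRestr (S hn μ)) (hμ : 5 < μ) (i j k : Fin 3) :
    coeffJet (e hn k) (e hn i) (e hn j) 0 g = 0 := by
  refine eq_zero_of_mem_zeroRestr _ (fun f hf hv => ?_) (fun f hf hv => ?_) hg
  · rw [coeffJet_mk, iteratedDeriv_zero, zero_smul]
    exact SmoothNear.apply_zero_of_vanishing (hv _) hμ
  · rw [coeffJet_d, lineJet_zero, lineJet_zero,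
      (hf.apply_const _).fderiv_e_of_vanishing (hv _) hμ,
      (hf.apply_const _).fderiv_e_of_vanishing (hv _) hμ, sub_zero]

theorem coeffJet_zx_eq_zero (hg : g ∈ zeroRestr (S hn μ)) (hμ : 5 < μ) {k : ℕ} (hk : k + 4 < μ) :
    coeffJet (e hn 2) (e hn 0) (e hn 2) k g = 0 := by
  refine eq_zero_of_mem_zeroRestr _ (fun f hf hv => ?_) (fun f hf hv => ?_) hg
  · exact ((hf.apply_const _).jets_of_vanishing (hv _) hμ).2.1 k (by omega)
  · rw [coeffJet_d, ((hf.apply_const _).jets_of_vanishing (hv _) hμ).1 k (by omega),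
      (hf.apply_const _).lineJet_self,
      ((hf.apply_const _).jets_of_vanishing (hv _) hμ).2.1 (k + 1) (by omega), sub_zero]

/-- On dβ the left side reduces to -∂_z^(μ-3) β_x and ∂_y ω_xy to -∂_y² β_x, and `jets_of_vanishing`
relates the two. Neither has to vanish separately, as β_x = F shows. -/
theorem coeffJet_zx_top (hg : g ∈ zeroRestr (S hn μ)) (hμ : 5 < μ) :
    coeffJet (e hn 2) (e hn 0) (e hn 2) (μ - 4) g =
      (μ - 3).factorial / 2 * coeffJet (e hn 1) (e hn 0) (e hn 1) 1 g := by
  have := eq_zero_of_mem_zeroRestr (coeffJet (e hn 2) (e hn 0) (e hn 2) (μ - 4) -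
    ((μ - 3).factorial / 2 : ℝ) • coeffJet (e hn 1) (e hn 0) (e hn 1) 1)
    (fun f hf hv => ?_) (fun f hf hv => ?_) hg
  · simpa [sub_eq_zero] using this
  · rw [LinearMap.sub_apply, LinearMap.smul_apply, coeffJet_mk, coeffJet_mk,
      (hf.apply_const _).deriv_line_of_vanishing (hv _) hμ,
      ((hf.apply_const _).jets_of_vanishing (hv _) hμ).2.1 (μ - 4) (by omega)]
    simp
  · have h1 := ((hf.apply_const ![e hn 2]).jets_of_vanishing (hv _) hμ).1 (μ - 4) (by omega)
    have h2 := ((hf.apply_const ![e hn 0]).jets_of_vanishing (hv _) hμ).2.2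
    have h3 := ((hf.apply_const ![e hn 1]).hess_of_vanishing (hv _) hμ).1
    have hm : μ - 3 = μ - 4 + 1 := by omega
    rw [hm, ← (hf.apply_const _).lineJet_self, ← hm] at h2
    rw [LinearMap.sub_apply, LinearMap.smul_apply, coeffJet_d, coeffJet_d, h1, h2,
      (hf.apply_const _).lineJet_one, (hf.apply_const _).lineJet_one,
      (hf.apply_const _).hess_comm (e hn 1) (e hn 0), h3, smul_eq_mul]
    ring

/-- On dβ both sides contain -∂_y∂_z β_x, which need not vanish (β_x = G) but cancels in the
difference; the remaining terms ∂_x∂_z β_y and ∂_x∂_y β_z are zero. -/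
theorem coeffJet_mixed (hg : g ∈ zeroRestr (S hn μ)) (hμ : 5 < μ) :
    coeffJet (e hn 2) (e hn 0) (e hn 1) 1 g = coeffJet (e hn 1) (e hn 0) (e hn 2) 1 g := by
  have := eq_zero_of_mem_zeroRestr (coeffJet (e hn 2) (e hn 0) (e hn 1) 1 -
    coeffJet (e hn 1) (e hn 0) (e hn 2) 1) (fun f hf hv => ?_) (fun f hf hv => ?_) hg
  · simpa [sub_eq_zero] using this
  · rw [LinearMap.sub_apply, coeffJet_mk, coeffJet_mk,
      (hf.apply_const _).deriv_line_of_vanishing (hv _) hμ,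
      (hf.apply_const _).deriv_line_of_vanishing (hv _) hμ, sub_zero]
  · rw [LinearMap.sub_apply, coeffJet_d, coeffJet_d]
    simp only [(hf.apply_const _).lineJet_one]
    rw [(hf.apply_const _).hess_zero_two_of_vanishing (hv _) hμ,
      (hf.apply_const _).hess_comm (e hn 1) (e hn 0),
      ((hf.apply_const _).hess_of_vanishing (hv _) hμ).1,
      (hf.apply_const _).hess_comm (e hn 1) (e hn 2)]
    ring

theorem coeffJet_xyz_eq_zero (hg : g ∈ zeroRestr (S hn μ)) (hμ : 5 < μ) :
    coeffJet (e hn 0) (e hn 1) (e hn 2) 1 g = 0 := by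
  refine eq_zero_of_mem_zeroRestr _ (fun f hf hv => ?_) (fun f hf hv => ?_) hg
  · exact (hf.apply_const _).deriv_line_of_vanishing (hv _) hμ 0
  · rw [coeffJet_d, (hf.apply_const _).lineJet_one, (hf.apply_const _).lineJet_one,
      ((hf.apply_const _).hess_of_vanishing (hv _) hμ).1,
      (hf.apply_const _).hess_comm (e hn 0) (e hn 2),
      (hf.apply_const _).hess_zero_two_of_vanishing (hv _) hμ, sub_zero]

end Obstructions

/-! ### Exact forms and closedness in coordinates -/

section Exact

open Filter Topology
open scoped ContDiff

variable {E : Type*} [NormedAddCommGroup E] [NormedSpace ℝ E]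

/-- A covector, seen as an alternating `1`-form. -/
def oneForm (l : E →L[ℝ] ℝ) : E [⋀^Fin 1]→L[ℝ] ℝ :=
  ContinuousAlternatingMap.ofSubsingleton ℝ E ℝ (0 : Fin 1) l

theorem oneForm_apply (l : E →L[ℝ] ℝ) (v : Fin 1 → E) : oneForm l v = l (v 0) := rfl

theorem alt_two_ext {a b : E [⋀^Fin 2]→L[ℝ] ℝ} (h : ∀ u w, a ![u, w] = b ![u, w]) : a = b := by
  ext v
  have : v = ![v 0, v 1] := by ext i; fin_cases i <;> rfl
  rw [this, h]

theorem extDeriv_smul_oneForm {h : E → ℝ} {y : E} (hh : DifferentiableAt ℝ h y)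
    (l : E →L[ℝ] ℝ) :
    extDeriv (fun y => h y • oneForm l) y = wedge (fderiv ℝ h y) l := by
  refine alt_two_ext fun u w => ?_
  rw [extDeriv_one_apply (hh.smul_const _), wedge_apply]
  simp [oneForm_apply, fderiv_mul_const hh]
  ring

theorem SmoothNear.smul_const {F : Type*} [NormedAddCommGroup F] [NormedSpace ℝ F] {h : E → ℝ}
    (hh : SmoothNear h) (c : F) : SmoothNear fun y => h y • c :=
  hh.mono fun _ hy => hy.smul contDiffAt_const

theorem d_mk_smul_oneForm {h : E → ℝ} (hh : ContDiff ℝ ∞ h) (l : E →L[ℝ] ℝ)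
    {f : E → E [⋀^Fin 2]→L[ℝ] ℝ} (hf : SmoothNear f) (hfh : ∀ y, f y = wedge (fderiv ℝ h y) l) :
    d 2 (FormGerm.mk f hf) = 0 := by
  obtain rfl : f = extDeriv (fun y => h y • oneForm l) := by
    funext y
    rw [hfh, extDeriv_smul_oneForm (hh.differentiable (by simp)).differentiableAt]
  rw [d_mk]
  refine Subtype.ext (congrArg germ ?_)
  exact extDeriv_extDeriv (r := ∞) (hh.smul contDiff_const) (by simpa using ENat.LEInfty.out)

theorem d_const {p : ℕ} (a : E [⋀^Fin p]→L[ℝ] ℝ) (h : SmoothNear fun _ : E => a) :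
    d p (FormGerm.mk (fun _ => a) h) = 0 := by
  rw [d_mk]
  refine Subtype.ext (congrArg germ ?_)
  funext y
  rw [extDeriv, fderiv_fun_const]
  exact map_zero (ContinuousAlternatingMap.alternatizeUncurryFinCLM ℝ E ℝ (n := p))

theorem coeffJet_one_mk (v u w : E) {f : E → E [⋀^Fin 2]→L[ℝ] ℝ} (hf : SmoothNear f) :
    coeffJet v u w 1 (FormGerm.mk f hf) = fderiv ℝ (fun y => f y ![u, w]) 0 v := by
  rw [coeffJet_mk, ← (hf.apply_const ![u, w]).lineJet_self _ 0, lineJet_zero]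

/-- The left side is the value at 0 of dω on `u, v, w`. -/
theorem coeffJet_of_closed {g : FormGerm E 2} (hg : d 2 g = 0) (u v w : E) :
    coeffJet u v w 1 g - coeffJet v u w 1 g + coeffJet w u v 1 g = 0 := by
  obtain ⟨_, f, hf, rfl⟩ := g
  have h1 : extDeriv f =ᶠ[𝓝 0] fun _ => 0 := Germ.coe_eq.1 (congrArg Subtype.val hg)
  have h2 : extDeriv f 0 ![u, v, w] = 0 := by rw [h1.self_of_nhds]; rfl
  have e0 : Fin.removeNth 0 ![u, v, w] = ![v, w] := by ext i; fin_cases i <;> rfl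
  have e1 : Fin.removeNth 1 ![u, v, w] = ![u, w] := by ext i; fin_cases i <;> rfl
  have e2 : Fin.removeNth 2 ![u, v, w] = ![u, v] := by ext i; fin_cases i <;> rfl
  have hf' : SmoothNear f := hf
  rw [extDeriv_apply (hf'.contDiffAt.differentiableAt (by simp)), Fin.sum_univ_three, e0, e1, e2]
    at h2
  change coeffJet u v w 1 (FormGerm.mk f hf') - coeffJet v u w 1 (FormGerm.mk f hf') +
    coeffJet w u v 1 (FormGerm.mk f hf') = 0
  rw [coeffJet_one_mk, coeffJet_one_mk, coeffJet_one_mk]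
  simpa [sub_eq_add_neg] using h2

end Exact

/-! ### Closedness and independence of the generators -/

section Theta

open Filter Topology
open scoped ContDiff

variable {n : ℕ} {hn : 2 ≤ n} {μ : ℕ}

theorem coeffJet_monoForm (l i j v u w : Fin 3) (p k : ℕ) :
    coeffJet (e hn v) (e hn u) (e hn w) k (monoForm hn l p i j) =
      (if l = v then (if k = p then (k.factorial : ℝ) else 0) else
        if p = 0 ∧ k = 0 then 1 else 0) *
      ((if i = u then 1 else 0) * (if j = w then 1 else 0) -
        (if i = w then 1 else 0) * (if j = u then 1 else 0)) := by
  have h1 : coeffJet (e hn v) (e hn u) (e hn w) k (monoForm hn l p i j) =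
    iteratedDeriv k (fun s : ℝ => (x hn l (s • e hn v)) ^ p *
      wedge (x hn i) (x hn j) ![e hn u, e hn w]) 0 := rfl
  rw [h1, iteratedDeriv_mul_const_field]
  congr 1
  · simp only [map_smul, x_e, smul_eq_mul]
    by_cases h : l = v
    · simp only [h, if_true, mul_one]
      rw [iteratedDeriv_fun_pow_zero]
      split_ifs with hk <;> simp [hk]
    · simp only [h, if_false, mul_zero]
      rw [iteratedDeriv_const]
      rcases k with _ | k <;> rcases p with _ | p <;> simp
  · simp [wedge_apply, x_e]

theorem constForm_eq (l i j : Fin 3) : constForm hn i j = monoForm hn l 0 i j := by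
  simp [constForm, monoForm]

theorem d_theta (j : ℕ) : d 2 (θ hn j) = 0 := by
  have hx : ∀ i y, HasFDerivAt (x hn i) (x hn i) y := fun i y => (x hn i).hasFDerivAt
  have hpow : ∀ k : ℕ, d 2 (monoForm hn 2 k 0 2) = 0 := by
    intro k
    -- z^k dx∧dz = d(x z^k dz).
    refine d_mk_smul_oneForm (h := fun y => x hn 0 y * x hn 2 y ^ k) (by fun_prop) (x hn 2) _
      fun y => ?_
    rw [((hx 0 y).fun_mul ((hx 2 y).pow k)).fderiv]
    refine alt_two_ext fun u w => ?_
    simp [wedge_apply]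
    ring
  match j with
  | 0 => exact map_zero _
  | 1 => rw [θ, constForm_eq 2]; exact hpow 0
  | 2 => exact d_const _ contDiff_const.smoothNear
  | 3 => exact d_const _ contDiff_const.smoothNear
  | 4 =>
    have hs : SmoothNear fun y => x hn 2 y ^ 1 • wedge (x hn 0) (x hn 1) -
        x hn 0 y ^ 1 • wedge (x hn 1) (x hn 2) :=
      ContDiff.smoothNear ((((x hn 2).contDiff.pow 1).smul contDiff_const).sub
        (((x hn 0).contDiff.pow 1).smul contDiff_const))
    have h4 : θ hn 4 = FormGerm.mk _ hs := rfl
    rw [h4]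
    -- θ_4 = d(xz dy).
    refine d_mk_smul_oneForm (h := fun y => x hn 0 y * x hn 2 y) (by fun_prop) (x hn 1) _
      fun y => ?_
    rw [((hx 0 y).fun_mul (hx 2 y)).fderiv]
    refine alt_two_ext fun u w => ?_
    simp [wedge_apply]
    ring
  | k + 5 => exact hpow (k + 1)

variable (hn μ) in
/-- The linear combinations of `θ_1, …, θ_μ`. -/
def thetaComb : (Fin μ → ℝ) →ₗ[ℝ] FormGerm (Fin (2 * n) → ℝ) 2 :=
  Fintype.linearCombination ℝ fun i : Fin μ => θ hn (i.val + 1)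

theorem thetaComb_apply (c : Fin μ → ℝ) :
    thetaComb hn μ c = ∑ i : Fin μ, c i • θ hn (i.val + 1) := rfl

theorem map_thetaComb {L : FormGerm (Fin (2 * n) → ℝ) 2 →ₗ[ℝ] ℝ} {r : ℝ} (i : Fin μ)
    (hL : ∀ j, L (θ hn (j + 1)) = if j = i then r else 0) (c : Fin μ → ℝ) :
    L (thetaComb hn μ c) = c i * r := by
  rw [thetaComb_apply, map_sum, Finset.sum_eq_single i]
  · rw [map_smul, hL, if_pos rfl, smul_eq_mul]
  · intro j _ hj
    rw [map_smul, hL, if_neg (fun h => hj (Fin.ext h)), smul_zero]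
  · simp

theorem map_thetaComb_eq_zero {L : FormGerm (Fin (2 * n) → ℝ) 2 →ₗ[ℝ] ℝ}
    (hL : ∀ j, L (θ hn (j + 1)) = 0) (c : Fin μ → ℝ) : L (thetaComb hn μ c) = 0 := by
  rw [thetaComb_apply, map_sum]
  exact Finset.sum_eq_zero fun j _ => by rw [map_smul, hL, smul_zero]

theorem coeffJet_theta (v u w : Fin 3) (k j : ℕ) :
    coeffJet (e hn v) (e hn u) (e hn w) k (θ hn (j + 1)) =
    match j with
    | 0 => coeffJet (e hn v) (e hn u) (e hn w) k (monoForm hn 2 0 0 2)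
    | 1 => coeffJet (e hn v) (e hn u) (e hn w) k (monoForm hn 2 0 1 2)
    | 2 => coeffJet (e hn v) (e hn u) (e hn w) k (monoForm hn 2 0 0 1)
    | 3 => coeffJet (e hn v) (e hn u) (e hn w) k (monoForm hn 2 1 0 1) -
        coeffJet (e hn v) (e hn u) (e hn w) k (monoForm hn 0 1 1 2)
    | j + 4 => coeffJet (e hn v) (e hn u) (e hn w) k (monoForm hn 2 (j + 1) 0 2) := by
  match j with
  | 0 => rw [θ, constForm_eq 2]
  | 1 => rw [θ, constForm_eq 2]
  | 2 => rw [θ, constForm_eq 2]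
  | 3 => rw [θ, map_sub]; rfl
  | j + 4 => rfl

theorem coeffJet_xz_thetaComb (c : Fin μ → ℝ) {i : Fin μ} (hi : i.val = 0) :
    coeffJet (e hn 2) (e hn 0) (e hn 2) 0 (thetaComb hn μ c) = c i := by
  rw [map_thetaComb (r := 1) i, mul_one]
  rw [hi]
  rintro (_ | _ | _ | _ | j) <;> simp [coeffJet_theta, coeffJet_monoForm]

theorem coeffJet_yz_thetaComb (c : Fin μ → ℝ) {i : Fin μ} (hi : i.val = 1) :
    coeffJet (e hn 2) (e hn 1) (e hn 2) 0 (thetaComb hn μ c) = c i := by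
  rw [map_thetaComb (r := 1) i, mul_one]
  rw [hi]
  rintro (_ | _ | _ | _ | j) <;> simp [coeffJet_theta, coeffJet_monoForm]

theorem coeffJet_xy_thetaComb (c : Fin μ → ℝ) {i : Fin μ} (hi : i.val = 2) :
    coeffJet (e hn 2) (e hn 0) (e hn 1) 0 (thetaComb hn μ c) = c i := by
  rw [map_thetaComb (r := 1) i, mul_one]
  rw [hi]
  rintro (_ | _ | _ | _ | j) <;> simp [coeffJet_theta, coeffJet_monoForm]

/-- Each condition on zero restrictions isolates one coefficient, except the mixed one, which reads
c_4 + r = 0 and is used once c_4 = 0 is known. -/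
theorem eq_zero_of_add_mem_zeroRestr (hμ : 5 < μ) (c : Fin μ → ℝ) (r : ℝ)
    (h : thetaComb hn μ c + r • σ₁ hn ∈ zeroRestr (S hn μ)) : c = 0 ∧ r = 0 := by
  have hσ : ∀ v u w k, coeffJet (e hn v) (e hn u) (e hn w) k (σ₁ hn) =
      coeffJet (e hn v) (e hn u) (e hn w) k (monoForm hn 2 1 0 1) := fun _ _ _ _ => rfl
  have c0 : ∀ i : Fin μ, i.val = 0 → c i = 0 := fun i hi => by
    have h1 := coeffJet_zero_eq_zero h hμ 0 2 2
    rw [map_add, map_smul, coeffJet_xz_thetaComb c hi, hσ, coeffJet_monoForm] at h1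
    simpa using h1
  have c1 : ∀ i : Fin μ, i.val = 1 → c i = 0 := fun i hi => by
    have h1 := coeffJet_zero_eq_zero h hμ 1 2 2
    rw [map_add, map_smul, coeffJet_yz_thetaComb c hi, hσ, coeffJet_monoForm] at h1
    simpa using h1
  have c2 : ∀ i : Fin μ, i.val = 2 → c i = 0 := fun i hi => by
    have h1 := coeffJet_zero_eq_zero h hμ 0 1 2
    rw [map_add, map_smul, coeffJet_xy_thetaComb c hi, hσ, coeffJet_monoForm] at h1
    simpa using h1
  have c3 : c ⟨3, by omega⟩ = 0 := by
    have h1 := coeffJet_xyz_eq_zero h hμ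
    rw [map_add, map_smul, map_thetaComb (r := -1) ⟨3, by omega⟩, hσ, coeffJet_monoForm] at h1
    · simpa using h1
    · rintro (_ | _ | _ | _ | j) <;> simp [coeffJet_theta, coeffJet_monoForm]
  have hr : r = 0 := by
    have h1 := coeffJet_mixed h hμ
    rw [map_add, map_smul, map_thetaComb (r := 1) ⟨3, by omega⟩, hσ, coeffJet_monoForm,
      map_add, map_smul, map_thetaComb_eq_zero, hσ, coeffJet_monoForm] at h1
    · simpa [c3] using h1
    · rintro (_ | _ | _ | _ | j) <;> simp [coeffJet_theta, coeffJet_monoForm]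
    · rintro (_ | _ | _ | _ | j) <;> simp [coeffJet_theta, coeffJet_monoForm]
  have ck : ∀ (k : ℕ) (hk : k + 4 < μ), c ⟨k + 4, hk⟩ = 0 := by
    intro k hk
    have h1 : coeffJet (e hn 2) (e hn 0) (e hn 2) (k + 1)
        (thetaComb hn μ c + r • σ₁ hn) = 0 := by
      -- The index `k + 4` carries z^(k+1) dx∧dz. For the top power k + 1 = μ - 4 only the relation
      -- with ∂_y ω_xy is available, and no generator has a y dx∧dy term.
      rcases Nat.lt_or_ge (k + 5) μ with hlt | hge
      · exact coeffJet_zx_eq_zero h hμ (by omega)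
      · have : k + 1 = μ - 4 := by omega
        rw [this, coeffJet_zx_top h hμ, map_add, map_smul, map_thetaComb_eq_zero, hσ,
          coeffJet_monoForm]
        · simp
        · rintro (_ | _ | _ | _ | j) <;> simp [coeffJet_theta, coeffJet_monoForm]
    rw [map_add, map_smul, map_thetaComb (r := (k + 1).factorial) ⟨k + 4, hk⟩, hσ,
      coeffJet_monoForm] at h1
    · simpa [Nat.factorial_ne_zero] using h1
    · rintro (_ | _ | _ | _ | j) <;> simp [coeffJet_theta, coeffJet_monoForm, eq_comm]
  refine ⟨?_, hr⟩
  funext ⟨i, hi⟩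
  match i with
  | 0 => exact c0 _ rfl
  | 1 => exact c1 _ rfl
  | 2 => exact c2 _ rfl
  | 3 => exact c3
  | k + 4 => exact ck k hi

/-- If a closed form is `∑ c_i θ_i + r σ_1` up to forms with zero algebraic restriction, then
`r = 0`. -/
theorem eq_zero_of_closed (hμ : 5 < μ) {g : FormGerm (Fin (2 * n) → ℝ) 2} (hg : d 2 g = 0)
    (c : Fin μ → ℝ) (r : ℝ)
    (h : thetaComb hn μ c + r • σ₁ hn - g ∈ zeroRestr (S hn μ)) : r = 0 := by
  -- By `h2` and `h3` the dx∧dy∧dz coefficient of the differential at 0 vanishes on zero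
  -- restrictions; by `h1` and `h4` it vanishes on `g` and on the θ-part, so only the contribution
  -- `r` of σ_1 remains.
  have h1 := coeffJet_of_closed hg (e hn 0) (e hn 1) (e hn 2)
  have h2 := coeffJet_xyz_eq_zero h hμ
  have h3 := coeffJet_mixed h hμ
  have hc : d 2 (thetaComb hn μ c) = 0 := by
    rw [thetaComb_apply, map_sum]
    exact Finset.sum_eq_zero fun j _ => by rw [map_smul, d_theta, smul_zero]
  have h4 := coeffJet_of_closed hc (e hn 0) (e hn 1) (e hn 2)
  have hσ : ∀ v u w k, coeffJet (e hn v) (e hn u) (e hn w) k (σ₁ hn) =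
      coeffJet (e hn v) (e hn u) (e hn w) k (monoForm hn 2 1 0 1) := fun _ _ _ _ => rfl
  simp only [map_sub, map_add, map_smul, hσ, coeffJet_monoForm, smul_eq_mul] at h2 h3
  simp at h2 h3
  linarith

end Theta

/-! ### Reduction of coefficients modulo zero restrictions -/

section Reduction

open Filter Topology
open scoped ContDiff

section General

variable {E : Type*} [NormedAddCommGroup E] [NormedSpace ℝ E]

/-- Taking germs at `0`, as a linear map. -/
def germLin (p : ℕ) : (E → E [⋀^Fin p]→L[ℝ] ℝ) →ₗ[ℝ] AnyGerm E p where
  toFun := germ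
  map_add' _ _ := rfl
  map_smul' _ _ := rfl

/-- The forms whose germs at `0` belong to a given space of germs of smooth forms. -/
def repr {p : ℕ} (T : Submodule ℝ (FormGerm E p)) : Submodule ℝ (E → E [⋀^Fin p]→L[ℝ] ℝ) :=
  (T.map (FormGerm E p).subtype).comap (germLin p)

/-- With `repr`, relations between germs become pointwise identities between representatives, with
no smoothness proofs to carry along. -/
theorem mem_repr_iff {p : ℕ} {T : Submodule ℝ (FormGerm E p)} {f : E → E [⋀^Fin p]→L[ℝ] ℝ}
    (hf : SmoothNear f) : f ∈ repr T ↔ FormGerm.mk f hf ∈ T := by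
  rw [repr, Submodule.mem_comap, Submodule.mem_map]
  constructor
  · rintro ⟨g, hg, hgf⟩
    rwa [show FormGerm.mk f hf = g from Subtype.ext hgf.symm]
  · exact fun h => ⟨_, h, rfl⟩

theorem repr_mono {p : ℕ} {T T' : Submodule ℝ (FormGerm E p)} (h : T ≤ T') : repr T ≤ repr T' :=
  Submodule.comap_mono (Submodule.map_mono h)

theorem mem_repr_congr {p : ℕ} {T : Submodule ℝ (FormGerm E p)} {f g : E → E [⋀^Fin p]→L[ℝ] ℝ}
    (hf : f ∈ repr T) (h : ∀ᶠ y in 𝓝 0, f y = g y) : g ∈ repr T := by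
  have : germLin p f = germLin p g := Germ.coe_eq.2 h
  rwa [repr, Submodule.mem_comap, ← this]

theorem SmoothNear.mul {g h : E → ℝ} (hg : SmoothNear g) (hh : SmoothNear h) :
    SmoothNear fun y => g y * h y := by
  filter_upwards [hg, hh] with y h1 h2 using h1.mul h2

variable {N : Set E}

theorem smul_mem_repr_zeroRestr {g : E → ℝ} {a : E → E [⋀^Fin 2]→L[ℝ] ℝ} (hg : SmoothNear g)
    (ha : SmoothNear a) (hv : ∀ᶠ y in 𝓝 0, y ∈ N → g y = 0) :
    (fun y => g y • a y) ∈ repr (zeroRestr N) := by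
  have hs : SmoothNear fun y => g y • a y := by
    filter_upwards [hg, ha] with y h1 h2 using h1.smul h2
  rw [mem_repr_iff hs]
  exact Submodule.mem_sup_left (mem_vanishing _ (hv.mono fun y hy hyN => by rw [hy hyN, zero_smul]))

/-- `h dg ∧ l` has zero algebraic restriction to `N` if `g` vanishes on `N`. -/
theorem smul_wedge_fderiv_mem {g h : E → ℝ} (hg : SmoothNear g) (hh : SmoothNear h)
    (hv : ∀ᶠ y in 𝓝 0, y ∈ N → g y = 0) (l : E →L[ℝ] ℝ) :
    (fun y => h y • wedge (fderiv ℝ g y) l) ∈ repr (zeroRestr N) := by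
  -- h dg∧l = d(hg l) - g dh∧l, where hg l and g dh∧l vanish on `N`.
  have h1 : extDeriv (fun y => (h y * g y) • oneForm l) ∈ repr (zeroRestr N) := by
    have hs := (hh.mul hg).smul_const (oneForm l)
    rw [mem_repr_iff hs.smoothNear_extDeriv, ← d_mk hs]
    exact Submodule.mem_sup_right (Submodule.mem_map_of_mem (mem_vanishing _
      (hv.mono fun y hy hyN => by rw [hy hyN, mul_zero, zero_smul])))
  have h2 := smul_mem_repr_zeroRestr hg (hh.smul_const (oneForm l)).smoothNear_extDeriv hv
  refine mem_repr_congr (sub_mem h1 h2) ?_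
  filter_upwards [hg, hh] with y hgy hhy
  have dg := hgy.differentiableAt (by simp)
  have dh := hhy.differentiableAt (by simp)
  rw [Pi.sub_apply, extDeriv_smul_oneForm (dh.fun_mul dg), extDeriv_smul_oneForm dh,
    fderiv_fun_mul dh dg]
  refine alt_two_ext fun u w => ?_
  simp [wedge_apply]
  ring

end General

section Smu

variable {n : ℕ} {hn : 2 ≤ n} {μ : ℕ}

variable (hn) in
theorem smooth_x (i : Fin 3) : SmoothNear fun y => x hn i y := (x hn i).contDiff.smoothNear

theorem vanishing_prod : ∀ᶠ y in 𝓝 0, y ∈ S hn μ → x hn 1 y * x hn 2 y = 0 :=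
  Eventually.of_forall fun _ hy => hy.2.1

/-- A Hadamard expansion modulo the functions that vanish on `S`. -/
theorem SmoothNear.exists_hadamard (hn : 2 ≤ n) (μ : ℕ) {f : (Fin (2 * n) → ℝ) → ℝ}
    (hf : SmoothNear f) :
    ∃ g₀ g₁ g₂ r : (Fin (2 * n) → ℝ) → ℝ, SmoothNear g₀ ∧ SmoothNear g₁ ∧ SmoothNear g₂ ∧
      SmoothNear r ∧ (∀ᶠ y in 𝓝 0, y ∈ S hn μ → r y = 0) ∧
      ∀ᶠ y in 𝓝 0, f y = f 0 + x hn 0 y * g₀ y + x hn 1 y * g₁ y + x hn 2 y * g₂ y + r y := by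
  obtain ⟨G, hG, hG'⟩ := hf.exists_sub_eq 0
  -- `R` erases the first three coordinates, so it is zero on `S`; it produces the remainder `r`.
  set R : (Fin (2 * n) → ℝ) →L[ℝ] (Fin (2 * n) → ℝ) := ContinuousLinearMap.id ℝ _
    - (x hn 0).smulRight (e hn 0) - (x hn 1).smulRight (e hn 1) - (x hn 2).smulRight (e hn 2)
    with hR
  have hR0 : ∀ y ∈ S hn μ, R y = 0 := by
    rintro y ⟨-, -, hy⟩
    funext i
    have hval : ∀ j : Fin 3, x hn j y = y (Fin.castLE (by omega) j) := fun _ => rfl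
    by_cases hi : 3 ≤ i.val
    · simp [hR, hy i hi, e_apply_of_le hn _ hi]
    · obtain ⟨j, hj⟩ : ∃ j : Fin 3, i = Fin.castLE (by omega) j :=
        ⟨⟨i.val, by omega⟩, rfl⟩
      rw [hj]
      fin_cases j <;> simp [hR, hval, e, Fin.ext_iff]
  refine ⟨fun y => G y (e hn 0), fun y => G y (e hn 1), fun y => G y (e hn 2),
    fun y => G y (R y), (hG.clm_apply contDiff_const).smoothNear,
    (hG.clm_apply contDiff_const).smoothNear, (hG.clm_apply contDiff_const).smoothNear,
    (hG.clm_apply R.contDiff).smoothNear,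
    Eventually.of_forall fun y hy => by simp only [hR0 y hy, map_zero], ?_⟩
  filter_upwards [hG'] with y hy
  have hy' : R y = y - x hn 0 y • e hn 0 - x hn 1 y • e hn 1 - x hn 2 y • e hn 2 := by simp [hR]
  simp only [zero_apply, sub_zero] at hy
  rw [hy', map_sub, map_sub, map_sub, map_smul, map_smul, map_smul, ← hy]
  simp only [smul_eq_mul]
  ring

variable (hn) in
/-- The form `h dx_i ∧ dx_j`. -/
def coeffForm (i j : Fin 3) : ((Fin (2 * n) → ℝ) → ℝ) →ₗ[ℝ]
    ((Fin (2 * n) → ℝ) → (Fin (2 * n) → ℝ) [⋀^Fin 2]→L[ℝ] ℝ) where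
  toFun h y := h y • wedge (x hn i) (x hn j)
  map_add' _ _ := by funext y; exact add_smul _ _ _
  map_smul' _ _ := by funext y; exact mul_smul _ _ _

theorem coeffForm_apply (i j : Fin 3) (h : (Fin (2 * n) → ℝ) → ℝ) (y : Fin (2 * n) → ℝ) :
    coeffForm hn i j h y = h y • wedge (x hn i) (x hn j) := rfl

theorem smooth_coeffForm (i j : Fin 3) {h : (Fin (2 * n) → ℝ) → ℝ} (hh : SmoothNear h) :
    SmoothNear (coeffForm hn i j h) :=
  hh.smul_const _

variable {h : (Fin (2 * n) → ℝ) → ℝ}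

theorem coeffForm_mem_of_vanishing (hh : SmoothNear h)
    (hv : ∀ᶠ y in 𝓝 0, y ∈ S hn μ → h y = 0) (i j : Fin 3) :
    coeffForm hn i j h ∈ repr (zeroRestr (S hn μ)) :=
  smul_mem_repr_zeroRestr hh contDiff_const.smoothNear hv

theorem dG_mem (hh : SmoothNear h) (i : Fin 3) :
    coeffForm hn 2 i (fun y => x hn 1 y * h y) + coeffForm hn 1 i (fun y => x hn 2 y * h y)
      ∈ repr (zeroRestr (S hn μ)) := by
  refine mem_repr_congr (smul_wedge_fderiv_mem ((smooth_x hn 1).mul (smooth_x hn 2)) hh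
    vanishing_prod (x hn i)) (Eventually.of_forall fun y => ?_)
  rw [((x hn 1).hasFDerivAt.fun_mul (x hn 2).hasFDerivAt).fderiv]
  refine alt_two_ext fun u w => ?_
  simp [wedge_apply, coeffForm_apply]
  ring

theorem dF_mem (hh : SmoothNear h) (i : Fin 3) :
    coeffForm hn 0 i (fun y => 2 * x hn 0 y * h y) - coeffForm hn 1 i (fun y => 2 * x hn 1 y * h y)
      - coeffForm hn 2 i (fun y => (μ - 3 : ℕ) * x hn 2 y ^ (μ - 4) * h y)
      ∈ repr (zeroRestr (S hn μ)) := by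
  have hF : SmoothNear fun y => x hn 0 y ^ 2 - x hn 1 y ^ 2 - x hn 2 y ^ (μ - 3) :=
    ContDiff.smoothNear (by fun_prop)
  refine mem_repr_congr (smul_wedge_fderiv_mem hF hh
    (Eventually.of_forall fun _ hy => hy.1) (x hn i)) (Eventually.of_forall fun y => ?_)
  rw [((((x hn 0).hasFDerivAt.pow 2).fun_sub ((x hn 1).hasFDerivAt.pow 2)).fun_sub
    ((x hn 2).hasFDerivAt.pow (μ - 3))).fderiv]
  refine alt_two_ext fun u w => ?_
  simp [wedge_apply, coeffForm_apply, show μ - 3 - 1 = μ - 4 by omega]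
  ring

theorem coeffForm_congr {f : (Fin (2 * n) → ℝ) → (Fin (2 * n) → ℝ) [⋀^Fin 2]→L[ℝ] ℝ}
    {T : Submodule ℝ (FormGerm (Fin (2 * n) → ℝ) 2)} (hf : f ∈ repr T)
    {g : (Fin (2 * n) → ℝ) → (Fin (2 * n) → ℝ) [⋀^Fin 2]→L[ℝ] ℝ}
    (h : ∀ y u w, f y ![u, w] = g y ![u, w]) : g ∈ repr T :=
  mem_repr_congr hf (Eventually.of_forall fun y => alt_two_ext (h y))

theorem z_yz_mem (hh : SmoothNear h) :
    coeffForm hn 1 2 (fun y => x hn 2 y * h y) ∈ repr (zeroRestr (S hn μ)) :=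
  coeffForm_congr (dG_mem hh 2) fun y u w => by
    simp only [Pi.add_apply, coeffForm_apply, ContinuousAlternatingMap.add_apply,
      ContinuousAlternatingMap.smul_apply, wedge_apply, smul_eq_mul]
    ring

theorem y_yz_mem (hh : SmoothNear h) :
    coeffForm hn 1 2 (fun y => x hn 1 y * h y) ∈ repr (zeroRestr (S hn μ)) :=
  coeffForm_congr (neg_mem (dG_mem hh 1)) fun y u w => by
    simp only [Pi.neg_apply, Pi.add_apply, coeffForm_apply, ContinuousAlternatingMap.neg_apply,
      ContinuousAlternatingMap.add_apply, ContinuousAlternatingMap.smul_apply, wedge_apply,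
      smul_eq_mul]
    ring

theorem y_xz_add_mem (hh : SmoothNear h) :
    coeffForm hn 0 2 (fun y => x hn 1 y * h y) + coeffForm hn 0 1 (fun y => x hn 2 y * h y)
      ∈ repr (zeroRestr (S hn μ)) :=
  coeffForm_congr (neg_mem (dG_mem hh 0)) fun y u w => by
    simp [wedge_apply, coeffForm_apply]; ring

/-- dF∧dz = 2x dx∧dz - 2y dy∧dz, and the second term is already zero. -/
theorem x_xz_mem (hh : SmoothNear h) :
    coeffForm hn 0 2 (fun y => x hn 0 y * h y) ∈ repr (zeroRestr (S hn μ)) :=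
  coeffForm_congr (add_mem (Submodule.smul_mem _ (1 / 2 : ℝ) (dF_mem hh 2)) (y_yz_mem hh))
    fun y u w => by simp [wedge_apply, coeffForm_apply]; ring

/-- dF∧dy = 2x dx∧dy + (μ-3) z^(μ-4) dy∧dz; since μ - 4 ≥ 1 the last term is a multiple of z dy∧dz.
-/
theorem x_xy_mem (hμ : 5 < μ) (hh : SmoothNear h) :
    coeffForm hn 0 1 (fun y => x hn 0 y * h y) ∈ repr (zeroRestr (S hn μ)) := by
  have hs : SmoothNear fun y => ((μ - 3 : ℕ) * x hn 2 y ^ (μ - 5) : ℝ) * h y :=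
    SmoothNear.mul (ContDiff.smoothNear (by fun_prop)) hh
  have hm : μ - 4 = μ - 5 + 1 := by omega
  refine coeffForm_congr (Submodule.smul_mem _ (1 / 2 : ℝ) (sub_mem (dF_mem hh 1) (z_yz_mem hs)))
    fun y u w => ?_
  simp [wedge_apply, coeffForm_apply, hm, pow_succ]
  ring

theorem y_xy_add_mem (hh : SmoothNear h) :
    coeffForm hn 0 1 (fun y => x hn 1 y * h y) + ((μ - 3 : ℕ) / 2 : ℝ) •
      coeffForm hn 0 2 (fun y => x hn 2 y ^ (μ - 4) * h y) ∈ repr (zeroRestr (S hn μ)) := by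
  refine coeffForm_congr (Submodule.smul_mem _ (1 / 2 : ℝ) (dF_mem hh 0)) fun y u w => ?_
  simp [wedge_apply, coeffForm_apply]
  ring

/-- Replace x² by y² + z^(μ-3) using F; y dy∧dz and z dy∧dz are zero. -/
theorem xx_yz_mem (hμ : 5 < μ) (hh : SmoothNear h) :
    coeffForm hn 1 2 (fun y => x hn 0 y * (x hn 0 y * h y)) ∈ repr (zeroRestr (S hn μ)) := by
  have h1 : coeffForm hn 1 2
      (fun y => (x hn 0 y ^ 2 - x hn 1 y ^ 2 - x hn 2 y ^ (μ - 3)) * h y)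
      ∈ repr (zeroRestr (S hn μ)) :=
    coeffForm_mem_of_vanishing (SmoothNear.mul (ContDiff.smoothNear (by fun_prop)) hh)
      (Eventually.of_forall fun y hy => by rw [hy.1, zero_mul]) 1 2
  have hs : SmoothNear fun y => x hn 2 y ^ (μ - 4) * h y :=
    SmoothNear.mul (ContDiff.smoothNear (by fun_prop)) hh
  have hm : μ - 3 = μ - 4 + 1 := by omega
  refine coeffForm_congr (add_mem (add_mem h1 (y_yz_mem ((smooth_x hn 1).mul hh))) (z_yz_mem hs))
    fun y u w => ?_
  simp [wedge_apply, coeffForm_apply, hm, pow_succ]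
  ring

theorem yz_mem (i j : Fin 3) (hh : SmoothNear h) :
    coeffForm hn i j (fun y => x hn 1 y * x hn 2 y * h y) ∈ repr (zeroRestr (S hn μ)) :=
  coeffForm_mem_of_vanishing (((smooth_x hn 1).mul (smooth_x hn 2)).mul hh)
    (Eventually.of_forall fun y hy => by rw [hy.2.1, zero_mul]) i j

/-- z² dx∧dy ≡ -yz dx∧dz, a multiple of G. -/
theorem zz_xy_mem (hh : SmoothNear h) :
    coeffForm hn 0 1 (fun y => x hn 2 y * (x hn 2 y * h y)) ∈ repr (zeroRestr (S hn μ)) :=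
  coeffForm_congr (sub_mem (y_xz_add_mem ((smooth_x hn 2).mul hh)) (yz_mem 0 2 hh)) fun y u w => by
    simp [wedge_apply, coeffForm_apply]; ring

/-- Modulo F, z^(μ-3) dx∧dz ≡ x² dx∧dz - y² dx∧dz. The first term is zero, and y² dx∧dz ≡ -yz dx∧dy
≡ 0. -/
theorem zpow_xz_mem (hh : SmoothNear h) :
    coeffForm hn 0 2 (fun y => x hn 2 y ^ (μ - 3) * h y) ∈ repr (zeroRestr (S hn μ)) := by
  have h1 : coeffForm hn 0 2
      (fun y => (x hn 0 y ^ 2 - x hn 1 y ^ 2 - x hn 2 y ^ (μ - 3)) * h y)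
      ∈ repr (zeroRestr (S hn μ)) :=
    coeffForm_mem_of_vanishing (SmoothNear.mul (ContDiff.smoothNear (by fun_prop)) hh)
      (Eventually.of_forall fun y hy => by rw [hy.1, zero_mul]) 0 2
  refine coeffForm_congr (add_mem (sub_mem (sub_mem (x_xz_mem ((smooth_x hn 0).mul hh)) h1)
    (y_xz_add_mem ((smooth_x hn 1).mul hh))) (yz_mem 0 1 hh)) fun y u w => ?_
  simp [wedge_apply, coeffForm_apply]
  ring

/-- The span of the generators, modulo the forms with zero algebraic restriction. -/
def genSpan (hn : 2 ≤ n) (μ : ℕ) : Submodule ℝ (FormGerm (Fin (2 * n) → ℝ) 2) :=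
  zeroRestr (S hn μ) ⊔ (LinearMap.range (thetaComb hn μ) ⊔ Submodule.span ℝ {σ₁ hn})

theorem zero_le_genSpan : repr (zeroRestr (S hn μ)) ≤ repr (genSpan hn μ) :=
  repr_mono le_sup_left

theorem theta_mem_genSpan (j : ℕ) (hj : j < μ) : θ hn (j + 1) ∈ genSpan hn μ := by
  refine Submodule.mem_sup_right (Submodule.mem_sup_left ⟨Pi.single ⟨j, hj⟩ 1, ?_⟩)
  rw [thetaComb_apply, Finset.sum_eq_single ⟨j, hj⟩]
  · simp
  · intro b _ hb
    simp [hb]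
  · simp

theorem sigma_mem_genSpan : σ₁ hn ∈ genSpan hn μ :=
  Submodule.mem_sup_right (Submodule.mem_sup_right (Submodule.mem_span_singleton_self _))

theorem monoForm_mem {T : Submodule ℝ (FormGerm (Fin (2 * n) → ℝ) 2)} {l i j : Fin 3} {k : ℕ}
    (hT : monoForm hn l k i j ∈ T) (c : ℝ) :
    coeffForm hn i j (fun y => x hn l y ^ k * c) ∈ repr T := by
  have h1 : coeffForm hn i j (fun y => x hn l y ^ k) ∈ repr T := by
    rw [mem_repr_iff (smooth_coeffForm i j (ContDiff.smoothNear (by fun_prop)))]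
    exact hT
  exact coeffForm_congr (Submodule.smul_mem _ c h1) fun y u w => by
    simp [coeffForm_apply]; ring

/-- To show that `p h dx_i ∧ dx_j` lies in a given space it suffices to treat the terms of a
Hadamard expansion of `h`. -/
theorem coeffForm_mem_of_hadamard {p : (Fin (2 * n) → ℝ) → ℝ} (hp : SmoothNear p)
    {T : Submodule ℝ (FormGerm (Fin (2 * n) → ℝ) 2)} (hT : repr (zeroRestr (S hn μ)) ≤ repr T)
    {i j : Fin 3} (h0 : ∀ c : ℝ, coeffForm hn i j (fun y => p y * c) ∈ repr T)
    (h1 : ∀ l, ∀ g : (Fin (2 * n) → ℝ) → ℝ, SmoothNear g →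
      coeffForm hn i j (fun y => x hn l y * (p y * g y)) ∈ repr T) (hh : SmoothNear h) :
    coeffForm hn i j (fun y => p y * h y) ∈ repr T := by
  obtain ⟨g₀, g₁, g₂, r, hg₀, hg₁, hg₂, hr, hrv, hexp⟩ := hh.exists_hadamard hn μ
  have h2 := hT (coeffForm_mem_of_vanishing (hp.mul hr)
    (hrv.mono fun y hy hyS => by rw [hy hyS, mul_zero]) i j)
  refine mem_repr_congr (add_mem (add_mem (add_mem (add_mem (h0 (h 0)) (h1 0 g₀ hg₀)) (h1 1 g₁ hg₁))
    (h1 2 g₂ hg₂)) h2) (hexp.mono fun y hy => ?_)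
  simp only [Pi.add_apply, coeffForm_apply, ← add_smul]
  congr 1
  rw [hy]
  ring

theorem smoothNear_const {F G : Type*} [NormedAddCommGroup F] [NormedSpace ℝ F]
    [NormedAddCommGroup G] [NormedSpace ℝ G] (c : G) : SmoothNear fun _ : F => c :=
  contDiff_const.smoothNear

theorem z_xy_mem_genSpan (hμ : 5 < μ) (hh : SmoothNear h) :
    coeffForm hn 0 1 (fun y => x hn 2 y * h y) ∈ repr (genSpan hn μ) := by
  refine coeffForm_mem_of_hadamard (smooth_x hn 2) zero_le_genSpan (fun c => ?_)
    (fun l g hg => ?_) hh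
  · simpa using monoForm_mem (T := genSpan hn μ) (l := 2) (k := 1) sigma_mem_genSpan c
  · refine zero_le_genSpan ?_
    fin_cases l
    · exact x_xy_mem hμ ((smooth_x hn 2).mul hg)
    · simpa [mul_assoc] using yz_mem (μ := μ) 0 1 hg
    · exact zz_xy_mem hg

/-- Descending induction on `k` from μ - 3, where the form is zero: the constant term of `h` gives a
θ, the x-term dies, the y-term becomes a multiple of z dx∧dy, and the z-term raises `k`. -/
theorem zpow_xz_mem_genSpan (hμ : 5 < μ) (k : ℕ) (hk : k ≤ μ - 3) (hh : SmoothNear h) :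
    coeffForm hn 0 2 (fun y => x hn 2 y ^ k * h y) ∈ repr (genSpan hn μ) := by
  obtain ⟨p, hp⟩ := Nat.exists_eq_add_of_le hk
  induction p generalizing k h with
  | zero =>
    obtain rfl : k = μ - 3 := by omega
    exact zero_le_genSpan (zpow_xz_mem hh)
  | succ p ih =>
    have hp : SmoothNear fun y => x hn 2 y ^ k := ContDiff.smoothNear (by fun_prop)
    refine coeffForm_mem_of_hadamard hp zero_le_genSpan (fun c => ?_) (fun l g hg => ?_) hh
    · refine monoForm_mem ?_ c
      rcases k with _ | k
      · rw [← constForm_eq]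
        exact theta_mem_genSpan 0 (by omega)
      · exact theta_mem_genSpan (k + 4) (by omega)
    · fin_cases l
      · exact zero_le_genSpan (x_xz_mem (hp.mul hg))
      · have := sub_mem (zero_le_genSpan (y_xz_add_mem (hn := hn) (μ := μ) (hp.mul hg)))
          (z_xy_mem_genSpan hμ (hp.mul hg))
        rwa [add_sub_cancel_right] at this
      · exact coeffForm_congr (ih (k + 1) (by omega) hg (by omega)) fun y u w => by
          simp only [Fin.reduceFinMk, coeffForm_apply, pow_succ, ContinuousAlternatingMap.smul_apply,
            smul_eq_mul]
          ring

theorem xz_mem_genSpan (hμ : 5 < μ) (hh : SmoothNear h) :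
    coeffForm hn 0 2 h ∈ repr (genSpan hn μ) := by
  simpa using zpow_xz_mem_genSpan hμ 0 (by omega) hh

theorem xy_mem_genSpan (hμ : 5 < μ) (hh : SmoothNear h) :
    coeffForm hn 0 1 h ∈ repr (genSpan hn μ) := by
  have := coeffForm_mem_of_hadamard (μ := μ) (T := genSpan hn μ) (i := 0) (j := 1)
    (smoothNear_const (F := Fin (2 * n) → ℝ) (1 : ℝ)) zero_le_genSpan (fun c => ?_)
    (fun l g hg => ?_) hh
  · simpa using this
  · have h3 : monoForm hn 0 0 0 1 ∈ genSpan hn μ := by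
      rw [← constForm_eq]
      exact theta_mem_genSpan 2 (by omega)
    simpa using monoForm_mem h3 c
  · simp only [one_mul]
    fin_cases l
    · exact zero_le_genSpan (x_xy_mem hμ hg)
    · have := sub_mem (zero_le_genSpan (y_xy_add_mem (hn := hn) (μ := μ) hg))
        (Submodule.smul_mem _ ((μ - 3 : ℕ) / 2 : ℝ)
          (zpow_xz_mem_genSpan hμ (μ - 4) (by omega) hg))
      rwa [add_sub_cancel_right] at this
    · exact z_xy_mem_genSpan hμ hg

theorem x_yz_mem_genSpan (hμ : 5 < μ) (hh : SmoothNear h) :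
    coeffForm hn 1 2 (fun y => x hn 0 y * h y) ∈ repr (genSpan hn μ) := by
  refine coeffForm_mem_of_hadamard (smooth_x hn 0) zero_le_genSpan (fun c => ?_)
    (fun l g hg => ?_) hh
  · have h4 : σ₂ hn ∈ genSpan hn μ := by
      have := sub_mem (sigma_mem_genSpan (hn := hn) (μ := μ))
        (theta_mem_genSpan (hn := hn) (μ := μ) 3 (by omega))
      rwa [θ, sub_sub_cancel] at this
    simpa using monoForm_mem (T := genSpan hn μ) (l := 0) (k := 1) h4 c
  · refine zero_le_genSpan ?_
    fin_cases l
    · exact xx_yz_mem hμ hg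
    · exact y_yz_mem ((smooth_x hn 0).mul hg)
    · exact z_yz_mem ((smooth_x hn 0).mul hg)

theorem yz_mem_genSpan (hμ : 5 < μ) (hh : SmoothNear h) :
    coeffForm hn 1 2 h ∈ repr (genSpan hn μ) := by
  have := coeffForm_mem_of_hadamard (μ := μ) (T := genSpan hn μ) (i := 1) (j := 2)
    (smoothNear_const (F := Fin (2 * n) → ℝ) (1 : ℝ)) zero_le_genSpan (fun c => ?_)
    (fun l g hg => ?_) hh
  · simpa using this
  · have h3 : monoForm hn 0 0 1 2 ∈ genSpan hn μ := by
      rw [← constForm_eq]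
      exact theta_mem_genSpan 1 (by omega)
    simpa using monoForm_mem h3 c
  · simp only [one_mul]
    fin_cases l
    · exact x_yz_mem_genSpan hμ hg
    · exact zero_le_genSpan (y_yz_mem hg)
    · exact zero_le_genSpan (z_yz_mem hg)

theorem coeffForm_swap (i j : Fin 3) : coeffForm hn j i h = -coeffForm hn i j h := by
  funext y
  refine alt_two_ext fun u w => ?_
  simp [coeffForm_apply, wedge_apply]
  ring

theorem coeffForm_self (i : Fin 3) : coeffForm hn i i h = 0 := by
  funext y
  refine alt_two_ext fun u w => ?_
  simp [coeffForm_apply, wedge_apply]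
  right; ring

theorem coeffForm_mem_genSpan (hμ : 5 < μ) (hh : SmoothNear h) (i j : Fin 3) :
    coeffForm hn i j h ∈ repr (genSpan hn μ) := by
  wlog hij : i < j generalizing i j
  · rcases (not_lt.1 hij).eq_or_lt with rfl | hlt
    · rw [coeffForm_self]
      exact zero_mem _
    · rw [coeffForm_swap j i]
      exact neg_mem (this j i hlt)
  fin_cases i <;> fin_cases j <;> first | exact absurd hij (by decide) | skip
  · exact xy_mem_genSpan hμ hh
  · exact xz_mem_genSpan hμ hh
  · exact yz_mem_genSpan hμ hh

end Smu

/-! ### From the first three coordinates to the whole space -/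

section Full

variable {n : ℕ} {hn : 2 ≤ n} {μ : ℕ}

theorem wedge_swap {E : Type*} [NormedAddCommGroup E] [NormedSpace ℝ E] (a b : E →L[ℝ] ℝ) :
    wedge b a = -wedge a b := by
  refine alt_two_ext fun u w => ?_
  simp [wedge_apply]
  ring

/-- The coordinate functions on `ℝ^N`. -/
def coord {N : ℕ} (i : Fin N) : (Fin N → ℝ) →L[ℝ] ℝ := ContinuousLinearMap.proj i

theorem alt_two_eq_sum {N : ℕ} (a : (Fin N → ℝ) [⋀^Fin 2]→L[ℝ] ℝ) :
    -- The sum runs over ordered pairs, hence the factor 1/2.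
    a = ∑ i, ∑ j, (a ![Pi.single i 1, Pi.single j 1] / 2) • wedge (coord i) (coord j) := by
  refine ContinuousAlternatingMap.toAlternatingMap_injective
    ((Pi.basisFun ℝ (Fin N)).ext_alternating fun v _ => ?_)
  have hv : (fun i => Pi.basisFun ℝ (Fin N) (v i)) = ![Pi.single (v 0) 1, Pi.single (v 1) 1] := by
    funext i
    fin_cases i <;> simp
  rw [hv]
  have hswap : a ![Pi.single (v 1) 1, Pi.single (v 0) 1]
      = -a ![Pi.single (v 0) 1, Pi.single (v 1) 1] := by
    have := a.map_swap ![Pi.single (v 0) 1, Pi.single (v 1) 1] (i := 0) (j := 1) (by decide)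
    refine Eq.trans (congrArg a ?_) this
    funext i
    fin_cases i <;> rfl
  simp [wedge_apply, coord, Pi.single_apply, mul_sub, Finset.sum_sub_distrib, hswap]
  ring

theorem wedge_coord_mem_zeroRestr (j : Fin (2 * n)) (hj : 3 ≤ j.val)
    {h : (Fin (2 * n) → ℝ) → ℝ} (hh : SmoothNear h) (l : (Fin (2 * n) → ℝ) →L[ℝ] ℝ) :
    (fun y => h y • wedge (coord j) l) ∈ repr (zeroRestr (S hn μ)) := by
  have h1 := smul_wedge_fderiv_mem (N := S hn μ) (coord j).contDiff.smoothNear hh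
    (Eventually.of_forall fun y hy => hy.2.2 j hj) l
  simpa only [ContinuousLinearMap.fderiv] using h1

theorem genSpan_eq_top (hμ : 5 < μ) : genSpan hn μ = ⊤ := by
  refine eq_top_iff.2 ?_
  rintro ⟨_, f, hf, rfl⟩ -
  have hf : SmoothNear f := hf
  refine (mem_repr_iff hf).1 ?_
  have hsum : f = ∑ i, ∑ j, fun y => (f y ![Pi.single i 1, Pi.single j 1] / 2) •
      wedge (coord i) (coord j) := by
    funext y
    rw [Finset.sum_apply]
    simp only [Finset.sum_apply]
    exact alt_two_eq_sum (f y)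
  rw [hsum]
  refine Submodule.sum_mem _ fun i _ => Submodule.sum_mem _ fun j _ => ?_
  have hs : SmoothNear fun y => f y ![Pi.single i 1, Pi.single j 1] / 2 :=
    (hf.apply_const _).mono fun y hy => hy.div_const 2
  by_cases hi : 3 ≤ i.val
  · exact zero_le_genSpan (wedge_coord_mem_zeroRestr i hi hs _)
  by_cases hj : 3 ≤ j.val
  · have := zero_le_genSpan (neg_mem (wedge_coord_mem_zeroRestr (hn := hn) (μ := μ) j hj hs
      (coord i)))
    refine coeffForm_congr this fun y u w => ?_
    rw [wedge_swap (coord j)]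
    simp
  exact coeffForm_mem_genSpan hμ hs ⟨i.val, by omega⟩ ⟨j.val, by omega⟩

end Full
end Reduction

/-! ### Closed restrictions and symplectic representatives for n ≥ 3 -/

section Symplectic

open Filter Topology
open scoped ContDiff

section General

variable {E : Type*} [NormedAddCommGroup E] [NormedSpace ℝ E]

theorem alt_two_swap (a : E [⋀^Fin 2]→L[ℝ] ℝ) (u w : E) : a ![w, u] = -a ![u, w] := by
  refine Eq.trans (congrArg a ?_) (a.map_swap ![u, w] (i := 0) (j := 1) (by decide))
  funext i
  fin_cases i <;> rfl

/-- A bilinear alternating form as a linear function of its second argument. -/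
def altRight (a : E [⋀^Fin 2]→L[ℝ] ℝ) (v : E) : E →ₗ[ℝ] ℝ where
  toFun w := a ![v, w]
  map_add' u w := by
    have h : ∀ z, ![v, z] = Function.update ![v, 0] 1 z := fun z => by
      funext i; fin_cases i <;> rfl
    simpa only [← h] using a.map_update_add ![v, 0] 1 u w
  map_smul' c w := by
    have h : ∀ z, ![v, z] = Function.update ![v, 0] 1 z := fun z => by
      funext i; fin_cases i <;> rfl
    simpa only [← h, RingHom.id_apply] using a.map_update_smul ![v, 0] 1 c w

theorem altRight_apply (a : E [⋀^Fin 2]→L[ℝ] ℝ) (v w : E) : altRight a v w = a ![v, w] := rfl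

end General

variable {n : ℕ} {hn : 2 ≤ n} {μ : ℕ}

theorem restr_eq_iff {N : Set (Fin (2 * n) → ℝ)} {g g' : FormGerm (Fin (2 * n) → ℝ) 2} :
    restr N g = restr N g' ↔ g - g' ∈ zeroRestr N :=
  Submodule.Quotient.eq _

theorem restr_eq_zero_iff {N : Set (Fin (2 * n) → ℝ)} {g : FormGerm (Fin (2 * n) → ℝ) 2} :
    restr N g = 0 ↔ g ∈ zeroRestr N :=
  Submodule.Quotient.mk_eq_zero _

theorem exists_sub_mem_zeroRestr (hn : 2 ≤ n) (hμ : 5 < μ) (g : FormGerm (Fin (2 * n) → ℝ) 2) :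
    ∃ (c : Fin μ → ℝ) (r : ℝ), thetaComb hn μ c + r • σ₁ hn - g ∈ zeroRestr (S hn μ) := by
  have hg : g ∈ genSpan hn μ := genSpan_eq_top hμ ▸ Submodule.mem_top
  obtain ⟨z, hz, _, ht, rfl⟩ := Submodule.mem_sup.1 hg
  obtain ⟨_, ⟨c, rfl⟩, _, hr, rfl⟩ := Submodule.mem_sup.1 ht
  obtain ⟨r, rfl⟩ := Submodule.mem_span_singleton.1 hr
  refine ⟨c, r, ?_⟩
  rw [sub_add_cancel_right]
  exact neg_mem hz

theorem d_thetaComb (c : Fin μ → ℝ) : d 2 (thetaComb hn μ c) = 0 := by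
  rw [thetaComb_apply, map_sum]
  exact Finset.sum_eq_zero fun j _ => by rw [map_smul, d_theta, smul_zero]

theorem exists_restr_eq_of_closed (hn : 2 ≤ n) (hμ : 5 < μ) {g : FormGerm (Fin (2 * n) → ℝ) 2}
    (hg : d 2 g = 0) : ∃ c : Fin μ → ℝ, thetaComb hn μ c - g ∈ zeroRestr (S hn μ) := by
  obtain ⟨c, r, h⟩ := exists_sub_mem_zeroRestr hn hμ g
  obtain rfl := eq_zero_of_closed hμ hg c r h
  exact ⟨c, by simpa using h⟩

variable (hn) in
/-- The germs of forms in `dx_1, dx_2, dx_3` only. -/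
def basicForms : Submodule ℝ (FormGerm (Fin (2 * n) → ℝ) 2) where
  carrier := {g | ∃ f, ∃ hf : SmoothNear f, g = FormGerm.mk f hf ∧
    ∀ y v w, (∀ i, x hn i v = 0) → f y ![v, w] = 0}
  zero_mem' := ⟨fun _ => 0, smoothNear_const 0, rfl, fun _ _ _ _ => rfl⟩
  add_mem' := by
    rintro _ _ ⟨f, hf, rfl, h1⟩ ⟨g, hg, rfl, h2⟩
    refine ⟨f + g, by filter_upwards [hf, hg] with y h3 h4 using h3.add h4, rfl, ?_⟩
    intro y v w hv
    simp [h1 y v w hv, h2 y v w hv]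
  smul_mem' := by
    rintro c _ ⟨f, hf, rfl, h1⟩
    refine ⟨c • f, by filter_upwards [hf] with y h3 using contDiffAt_const.smul h3, rfl, ?_⟩
    intro y v w hv
    simp [h1 y v w hv]

theorem monoForm_mem_basicForms (l i j : Fin 3) (k : ℕ) : monoForm hn l k i j ∈ basicForms hn :=
  ⟨fun y => x hn l y ^ k • wedge (x hn i) (x hn j), ContDiff.smoothNear (by fun_prop), rfl,
    fun y v w hv => by simp [wedge_apply, hv]⟩

theorem theta_mem_basicForms (j : ℕ) : θ hn j ∈ basicForms hn := by
  match j with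
  | 0 => exact zero_mem _
  | 1 => rw [θ, constForm_eq 2]; exact monoForm_mem_basicForms _ _ _ _
  | 2 => rw [θ, constForm_eq 2]; exact monoForm_mem_basicForms _ _ _ _
  | 3 => rw [θ, constForm_eq 2]; exact monoForm_mem_basicForms _ _ _ _
  | 4 => exact sub_mem (monoForm_mem_basicForms _ _ _ _) (monoForm_mem_basicForms _ _ _ _)
  | k + 5 => exact monoForm_mem_basicForms _ _ _ _

/-- At every point the kernel of such a representative contains the directions with x = y = z = 0,
so wedges with the other covectors can be added without interference. -/
theorem exists_rep_thetaComb (hn : 2 ≤ n) (c : Fin μ → ℝ) :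
    ∃ f, ∃ hf : SmoothNear f, thetaComb hn μ c = FormGerm.mk f hf ∧
      ∀ y v w, (∀ i, x hn i v = 0) → f y ![v, w] = 0 := by
  have : thetaComb hn μ c ∈ basicForms hn := by
    rw [thetaComb_apply]
    exact sum_mem fun i _ => Submodule.smul_mem _ _ (theta_mem_basicForms _)
  exact this

/-- Adding a constant form with zero algebraic restriction may turn a combination of the `θ_i` into
a symplectic form. -/
theorem restr_thetaComb_mem_sympRestr {c : Fin μ → ℝ}
    {f : (Fin (2 * n) → ℝ) → (Fin (2 * n) → ℝ) [⋀^Fin 2]→L[ℝ] ℝ} (hf : SmoothNear f)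
    (hc : thetaComb hn μ c = FormGerm.mk f hf) (a : (Fin (2 * n) → ℝ) [⋀^Fin 2]→L[ℝ] ℝ)
    (ha : (fun _ => a) ∈ repr (zeroRestr (S hn μ))) (hnd : ∀ᶠ y in 𝓝 0, Nondeg (f y + a)) :
    restr (S hn μ) (thetaComb hn μ c) ∈ sympRestr (S hn μ) := by
  refine ⟨thetaComb hn μ c + FormGerm.mk (fun _ => a) (smoothNear_const a), ⟨?_, ?_⟩, ?_⟩
  · rw [map_add, d_thetaComb, d_const, add_zero]
  · rw [hc]
    exact hnd
  · rw [restr_eq_iff, add_sub_cancel_left]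
    exact (mem_repr_iff _).1 ha

theorem const_wedge_coord_mem (l : (Fin (2 * n) → ℝ) →L[ℝ] ℝ) (j : Fin (2 * n))
    (hj : 3 ≤ j.val) : (fun _ => wedge l (coord j)) ∈ repr (zeroRestr (S hn μ)) := by
  have := wedge_coord_mem_zeroRestr (hn := hn) (μ := μ) j hj (smoothNear_const (-1 : ℝ)) l
  refine coeffForm_congr this fun y u w => ?_
  rw [wedge_swap l]
  simp

theorem x_single_of_le (i : Fin 3) {j : Fin (2 * n)} (hj : 3 ≤ j.val) :
    x hn i (Pi.single j 1) = 0 := by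
  have : Fin.castLE (by omega) i ≠ j := fun h => by
    have := congrArg Fin.val h
    simp at this
    omega
  simp [x, this]

theorem restr_thetaComb_mem_sympRestr_of_three_le (h3 : 3 ≤ n) (c : Fin μ → ℝ) :
    restr (S hn μ) (thetaComb hn μ c) ∈ sympRestr (S hn μ) := by
  obtain ⟨f, hf, hc, hfb⟩ := exists_rep_thetaComb hn c
  -- x_1, x_2, x_3 are paired with x_4, x_5, x_6 and the remaining coordinates consecutively. Every
  -- pair contains some x_j with j ≥ 4, so ∑ dp_i∧dq_i has zero restriction.
  set p : Fin n → Fin (2 * n) := fun i =>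
    if hi : i.val < 3 then ⟨i.val, by omega⟩ else ⟨2 * i.val, by omega⟩ with hp
  set q : Fin n → Fin (2 * n) := fun i =>
    if hi : i.val < 3 then ⟨i.val + 3, by omega⟩ else ⟨2 * i.val + 1, by omega⟩ with hq
  have hpv : ∀ i, (p i).val = if i.val < 3 then i.val else 2 * i.val := fun i => by
    simp only [hp]; split_ifs <;> rfl
  have hqv : ∀ i, (q i).val = if i.val < 3 then i.val + 3 else 2 * i.val + 1 := fun i => by
    simp only [hq]; split_ifs <;> rfl
  have hq3 : ∀ i, 3 ≤ (q i).val := fun i => by rw [hqv]; split_ifs <;> omega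
  have hpp : ∀ i j, p i = p j ↔ i = j := fun i j => by
    rw [Fin.ext_iff, Fin.ext_iff, hpv, hpv]; split_ifs <;> omega
  have hqq : ∀ i j, q i = q j ↔ i = j := fun i j => by
    rw [Fin.ext_iff, Fin.ext_iff, hqv, hqv]; split_ifs <;> omega
  have hpq : ∀ i j, p i ≠ q j := fun i j => by
    rw [Ne, Fin.ext_iff, hpv, hqv]; split_ifs <;> omega
  have hcover : ∀ j : Fin (2 * n), ∃ i, j = p i ∨ j = q i := by
    intro j
    obtain ⟨i, hi⟩ : ∃ i : ℕ, i < n ∧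
        (j.val = (if i < 3 then i else 2 * i) ∨ j.val = if i < 3 then i + 3 else 2 * i + 1) := by
      by_cases h1 : j.val < 3
      · exact ⟨j.val, by omega, Or.inl (by rw [if_pos h1])⟩
      by_cases h2 : j.val < 6
      · exact ⟨j.val - 3, by omega, Or.inr (by rw [if_pos (by omega)]; omega)⟩
      refine ⟨j.val / 2, by omega, ?_⟩
      rw [if_neg (by omega), if_neg (by omega)]
      omega
    refine ⟨⟨i, hi.1⟩, hi.2.imp (fun h => Fin.ext ?_) (fun h => Fin.ext ?_)⟩
    · exact h.trans (hpv ⟨i, hi.1⟩).symm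
    · exact h.trans (hqv ⟨i, hi.1⟩).symm
  refine restr_thetaComb_mem_sympRestr hf hc (∑ i, wedge (coord (p i)) (coord (q i))) ?_
    (Eventually.of_forall fun y v hv => ?_)
  · have : (fun _ : Fin (2 * n) → ℝ => ∑ i, wedge (coord (p i)) (coord (q i))) =
        ∑ i, fun _ => wedge (coord (p i)) (coord (q i)) := by
      funext y
      simp
    rw [this]
    exact sum_mem fun i _ => const_wedge_coord_mem _ _ (hq3 i)
  · have hwq : ∀ k, (∑ i, wedge (coord (p i)) (coord (q i))) ![v, Pi.single (q k) 1] = v (p k) := by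
      intro k
      rw [ContinuousAlternatingMap.sum_apply]
      simp [wedge_apply, coord, Pi.single_apply, hqq, hpq]
    have hwp : ∀ k, (∑ i, wedge (coord (p i)) (coord (q i))) ![v, Pi.single (p k) 1]
        = -v (q k) := by
      intro k
      rw [ContinuousAlternatingMap.sum_apply]
      simp [wedge_apply, coord, Pi.single_apply, hpp, (hpq _ _).symm]
    -- Testing against the q-directions, which `f` ignores, puts `v` in the kernel of `f`; testing
    -- against the p-directions then kills the rest of `v`.
    have hvp : ∀ k, v (p k) = 0 := by
      intro k
      have := hv (Pi.single (q k) 1)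
      rwa [ContinuousAlternatingMap.add_apply, hwq, alt_two_swap,
        hfb _ _ _ fun i => x_single_of_le i (hq3 k), neg_zero, zero_add] at this
    have hx : ∀ i, x hn i v = 0 := by
      intro i
      have : x hn i v = v (p ⟨i.val, by omega⟩) := by
        refine congrArg v (Fin.ext ?_)
        rw [hpv, if_pos i.isLt]
        rfl
      rw [this, hvp]
    have hvq : ∀ k, v (q k) = 0 := by
      intro k
      have := hv (Pi.single (p k) 1)
      rwa [ContinuousAlternatingMap.add_apply, hwp, hfb _ _ _ hx, zero_add, neg_eq_zero] at this
    funext j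
    obtain ⟨i, rfl | rfl⟩ := hcover j
    · exact hvp i
    · exact hvq i

end Symplectic

/-! ### The symplectic condition in dimension four -/

section Four

open Filter Topology

variable {hn : 2 ≤ 2} {μ : ℕ}

theorem vec_eq_sum (v : Fin (2 * 2) → ℝ) :
    v = x hn 0 v • e hn 0 + x hn 1 v • e hn 1 + x hn 2 v • e hn 2 + v 3 • Pi.single 3 1 := by
  funext i
  fin_cases i <;> simp [x, e, Fin.ext_iff]

theorem restr_thetaComb_mem_sympRestr_of_ne (c : Fin μ → ℝ) {i j k : Fin μ}
    (hi : i.val = 0) (hj : j.val = 1) (hk : k.val = 2)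
    (h : (c i, c j, c k) ≠ ((0, 0, 0) : ℝ × ℝ × ℝ)) :
    restr (S hn μ) (thetaComb hn μ c) ∈ sympRestr (S hn μ) := by
  obtain ⟨f, hf, hc, hfb⟩ := exists_rep_thetaComb hn c
  have t1 := coeffJet_xz_thetaComb (hn := hn) c hi
  have t2 := coeffJet_yz_thetaComb (hn := hn) c hj
  have t3 := coeffJet_xy_thetaComb (hn := hn) c hk
  rw [hc, coeffJet_mk, iteratedDeriv_zero, zero_smul] at t1 t2 t3
  set c₁ := c i
  set c₂ := c j
  set c₃ := c k
  -- This choice makes the Pfaffian of the sum with η∧dx_4 at 0 equal to c_1² + c_2² + c_3².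
  set η : (Fin (2 * 2) → ℝ) →L[ℝ] ℝ := c₂ • x hn 0 - c₁ • x hn 1 + c₃ • x hn 2 with hη
  refine restr_thetaComb_mem_sympRestr hf hc (wedge η (coord 3))
    (const_wedge_coord_mem _ _ le_rfl) ?_
  have hcont : ∀ u w, ContinuousAt (fun y => f y ![u, w]) 0 := fun u w =>
    (hf.apply_const ![u, w]).contDiffAt.continuousAt
  have hpf : ContinuousAt (fun y => c₃ * f y ![e hn 0, e hn 1] + c₁ * f y ![e hn 0, e hn 2]
      + c₂ * f y ![e hn 1, e hn 2]) 0 :=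
    ((continuousAt_const.mul (hcont _ _)).add (continuousAt_const.mul (hcont _ _))).add
      (continuousAt_const.mul (hcont _ _))
  have hpf0 : c₃ * f 0 ![e hn 0, e hn 1] + c₁ * f 0 ![e hn 0, e hn 2]
      + c₂ * f 0 ![e hn 1, e hn 2] ≠ 0 := by
    rw [t1, t2, t3]
    intro h0
    apply h
    have h1 : c₁ = 0 := by nlinarith [sq_nonneg c₁, sq_nonneg c₂, sq_nonneg c₃]
    have h2 : c₂ = 0 := by nlinarith [sq_nonneg c₁, sq_nonneg c₂, sq_nonneg c₃]
    have h3 : c₃ = 0 := by nlinarith [sq_nonneg c₁, sq_nonneg c₂, sq_nonneg c₃]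
    rw [h1, h2, h3]
  filter_upwards [hpf.eventually_ne hpf0] with y hy v hv
  have hx3 : ∀ i, x hn i (Pi.single 3 1) = 0 := fun i => x_single_of_le i le_rfl
  have he3 : ∀ i, e hn i 3 = 0 := fun i => e_apply_of_le hn i le_rfl
  have hself : ∀ u, f y ![u, u] = 0 := fun u => by
    have := alt_two_swap (f y) u u
    linarith
  have hval : ∀ w, f y ![v, w] = x hn 0 v * f y ![e hn 0, w] + x hn 1 v * f y ![e hn 1, w]
      + x hn 2 v * f y ![e hn 2, w] := by
    intro w
    have h1 := congrArg (altRight (f y) w) (vec_eq_sum (hn := hn) v)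
    simp only [map_add, map_smul, altRight_apply, smul_eq_mul] at h1
    rw [alt_two_swap (f y) (Pi.single 3 1) w, hfb _ _ _ hx3, alt_two_swap (f y) v,
      alt_two_swap (f y) (e hn 0), alt_two_swap (f y) (e hn 1), alt_two_swap (f y) (e hn 2)] at h1
    linarith
  have g0 := hv (e hn 0)
  have g1 := hv (e hn 1)
  have g2 := hv (e hn 2)
  have g3 := hv (Pi.single 3 1)
  rw [ContinuousAlternatingMap.add_apply, hval, wedge_apply] at g0 g1 g2 g3
  have hηw : ∀ w, η w = c₂ * x hn 0 w - c₁ * x hn 1 w + c₃ * x hn 2 w := fun _ => rfl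
  have hη0 : η (e hn 0) = c₂ := by rw [hηw, x_e, x_e, x_e]; simp
  have hη1 : η (e hn 1) = -c₁ := by rw [hηw, x_e, x_e, x_e]; simp
  have hη2 : η (e hn 2) = c₃ := by rw [hηw, x_e, x_e, x_e]; simp
  have hη3 : η (Pi.single 3 1) = 0 := by rw [hηw, hx3, hx3, hx3]; simp
  have hc3 : ∀ w : Fin (2 * 2) → ℝ, coord 3 w = w 3 := fun _ => rfl
  simp only [hself, alt_two_swap (f y) (e hn 0) (e hn 1), alt_two_swap (f y) (e hn 0) (e hn 2),
    alt_two_swap (f y) (e hn 1) (e hn 2), Matrix.cons_val_zero, Matrix.cons_val_one, hη0, hη1, hη2,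
    hη3, hηw v, hc3, he3, Pi.single_eq_same] at g0 g1 g2 g3
  have hz : ∀ i, f y ![e hn i, Pi.single 3 1] = 0 := fun i => by
    rw [alt_two_swap (f y) (Pi.single 3 1), hfb _ _ _ hx3, neg_zero]
  rw [hz, hz, hz] at g3
  set a := f y ![e hn 0, e hn 1]
  set b := f y ![e hn 0, e hn 2]
  set b' := f y ![e hn 1, e hn 2]
  -- The 4 × 4 skew system is inverted through its Pfaffian adjoint: each coordinate of `v` times
  -- the Pfaffian is a combination of the equations.
  have hv3 : v 3 = 0 := by
    refine (mul_eq_zero.1 (?_ : (c₃ * a + c₁ * b + c₂ * b') * v 3 = 0)).resolve_left hy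
    linear_combination -b' * g0 + b * g1 - a * g2
  have hv0 : x hn 0 v = 0 := by
    refine (mul_eq_zero.1 (?_ : (c₃ * a + c₁ * b + c₂ * b') * x hn 0 v = 0)).resolve_left hy
    linear_combination b' * g3 + c₃ * g1 + c₁ * g2
  have hv1 : x hn 1 v = 0 := by
    refine (mul_eq_zero.1 (?_ : (c₃ * a + c₁ * b + c₂ * b') * x hn 1 v = 0)).resolve_left hy
    linear_combination -b * g3 - c₃ * g0 + c₂ * g2
  have hv2 : x hn 2 v = 0 := by
    refine (mul_eq_zero.1 (?_ : (c₃ * a + c₁ * b + c₂ * b') * x hn 2 v = 0)).resolve_left hy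
    linear_combination a * g3 - c₁ * g0 - c₂ * g1
  rw [vec_eq_sum (hn := hn) v, hv0, hv1, hv2, hv3]
  simp

/-- A hyperplane of a four-dimensional symplectic vector space is not isotropic. -/
theorem not_nondeg_of_isotropic {a : (Fin (2 * 2) → ℝ) [⋀^Fin 2]→L[ℝ] ℝ}
    (h : ∀ i j, a ![e hn i, e hn j] = 0) : ¬ Nondeg a := by
  intro hnd
  have key : ∀ v, (∀ j, a ![v, e hn j] = 0) → a ![v, Pi.single 3 1] = 0 → v = 0 := by
    intro v h1 h2
    refine hnd v fun w => ?_
    rw [← altRight_apply, vec_eq_sum (hn := hn) w]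
    simp only [map_add, map_smul, altRight_apply, h1, h2, smul_zero, add_zero]
  have hlin : ∀ (r s : ℝ) w, a ![r • e hn 0 + s • e hn 1, w] =
      r * a ![e hn 0, w] + s * a ![e hn 1, w] := by
    intro r s w
    rw [alt_two_swap a w, ← altRight_apply, map_add, map_smul, map_smul, altRight_apply,
      altRight_apply, alt_two_swap a (e hn 0), alt_two_swap a (e hn 1)]
    simp
    ring
  -- This combination of `e 0` and `e 1` also pairs to zero with the fourth basis vector, so it lies
  -- in the kernel.
  have h1 := key (a ![e hn 1, Pi.single 3 1] • e hn 0 + (-a ![e hn 0, Pi.single 3 1]) • e hn 1)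
    (fun j => by rw [hlin, h, h]; ring) (by rw [hlin]; ring)
  have h2 : a ![e hn 0, Pi.single 3 1] = 0 := by
    have := congrArg (x hn 1) h1
    rw [map_add, map_smul, map_smul, x_e, x_e] at this
    simpa using this
  have h3 := congrArg (x hn 0) (key (e hn 0) (h 0) h2)
  rw [x_e] at h3
  simp at h3

theorem ne_of_restr_thetaComb_mem_sympRestr (hμ : 5 < μ) (c : Fin μ → ℝ)
    {i j k : Fin μ} (hi : i.val = 0) (hj : j.val = 1) (hk : k.val = 2)
    (h : restr (S hn μ) (thetaComb hn μ c) ∈ sympRestr (S hn μ)) :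
    (c i, c j, c k) ≠ ((0, 0, 0) : ℝ × ℝ × ℝ) := by
  obtain ⟨⟨_, f, hf, rfl⟩, ⟨-, hnd⟩, hw⟩ := h
  have hf : SmoothNear f := hf
  have hnd : ∀ᶠ y in 𝓝 0, Nondeg (f y) := hnd
  intro h0
  simp only [Prod.mk.injEq] at h0
  have t1 := coeffJet_xz_thetaComb (hn := hn) c hi
  have t2 := coeffJet_yz_thetaComb (hn := hn) c hj
  have t3 := coeffJet_xy_thetaComb (hn := hn) c hk
  rw [h0.1] at t1
  rw [h0.2.1] at t2
  rw [h0.2.2] at t3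
  have hz : ∀ i j, coeffJet (e hn 2) (e hn i) (e hn j) 0 (FormGerm.mk f hf) =
      coeffJet (e hn 2) (e hn i) (e hn j) 0 (thetaComb hn μ c) := fun i j => by
    rw [← sub_eq_zero, ← map_sub]
    exact coeffJet_zero_eq_zero (restr_eq_iff.1 hw) hμ i j 2
  have hz' : ∀ i j, coeffJet (e hn 2) (e hn i) (e hn j) 0 (FormGerm.mk f hf) =
      f 0 ![e hn i, e hn j] := fun i j => by
    rw [coeffJet_mk, iteratedDeriv_zero, zero_smul]
  refine not_nondeg_of_isotropic (hn := hn) (fun i j => ?_) hnd.self_of_nhds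
  wlog hij : i < j generalizing i j
  · rcases (not_lt.1 hij).eq_or_lt with rfl | hlt
    · have := alt_two_swap (f 0) (e hn j) (e hn j)
      linarith
    · rw [alt_two_swap, this j i hlt, neg_zero]
  rw [← hz', hz]
  fin_cases i <;> fin_cases j <;> first | exact absurd hij (by decide) | assumption

end Four

/-! ### Dimensions of the spaces of restrictions -/

section Main

variable {n : ℕ} {hn : 2 ≤ n} {μ : ℕ}

theorem restr_thetaComb_injective (hμ : 5 < μ) :
    Function.Injective ((restr (S hn μ)).comp (thetaComb hn μ)) := by
  rw [injective_iff_map_eq_zero]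
  intro c hc
  exact (eq_zero_of_add_mem_zeroRestr hμ c 0 (by simpa using! restr_eq_zero_iff.1 hc)).1

theorem finrank_restr (hμ : 5 < μ) : Module.finrank ℝ (Restr (S hn μ)) = μ + 1 := by
  set L : (Fin μ → ℝ) × ℝ →ₗ[ℝ] Restr (S hn μ) := (restr (S hn μ)).comp
    ((thetaComb hn μ).coprod (LinearMap.toSpanSingleton ℝ _ (σ₁ hn))) with hL
  have hLa : ∀ c r, L (c, r) = restr (S hn μ) (thetaComb hn μ c + r • σ₁ hn) := fun c r => by
    simp [hL]
  have hinj : Function.Injective L := by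
    rw [injective_iff_map_eq_zero]
    rintro ⟨c, r⟩ hc
    rw [hLa, restr_eq_zero_iff] at hc
    obtain ⟨rfl, rfl⟩ := eq_zero_of_add_mem_zeroRestr hμ c r hc
    rfl
  have hsurj : Function.Surjective L := by
    intro a
    obtain ⟨g, rfl⟩ := Submodule.mkQ_surjective _ a
    obtain ⟨c, r, h⟩ := exists_sub_mem_zeroRestr hn hμ g
    exact ⟨(c, r), by rw [hLa]; exact restr_eq_iff.2 h⟩
  rw [← (LinearEquiv.ofBijective L ⟨hinj, hsurj⟩).finrank_eq]
  simp

theorem closedRestr_eq_range (hμ : 5 < μ) :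
    closedRestr (S hn μ) = LinearMap.range ((restr (S hn μ)).comp (thetaComb hn μ)) := by
  refine le_antisymm ?_ ?_
  · rintro _ ⟨g, hg, rfl⟩
    obtain ⟨c, hc⟩ := exists_restr_eq_of_closed hn hμ hg
    exact ⟨c, restr_eq_iff.2 hc⟩
  · rintro _ ⟨c, rfl⟩
    exact ⟨thetaComb hn μ c, d_thetaComb c, rfl⟩

end Main
end AlgRestr
end

open AlgRestr in
theorem proposition4p3 (n : ℕ) (hn : 2 ≤ n) (μ : ℕ) (hμ : 5 < μ) :
    -- the space of algebraic restrictions of all 2-forms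
    (Module.finrank ℝ (Restr (S hn μ)) = μ + 1 ∧
      Submodule.span ℝ (restr (S hn μ) ''
        ({θ hn 1, θ hn 2, θ hn 3, σ₁ hn, σ₂ hn} ∪
          {w | ∃ k : ℕ, 1 ≤ k ∧ k ≤ μ - 4 ∧ w = θ hn (4 + k)})) = ⊤) ∧
    -- the subspace of algebraic restrictions of closed 2-forms
    (Module.finrank ℝ (closedRestr (S hn μ)) = μ ∧
      Submodule.span ℝ (restr (S hn μ) '' {w | ∃ j : ℕ, 1 ≤ j ∧ j ≤ μ ∧ w = θ hn j}) =
        closedRestr (S hn μ)) ∧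
    -- realizability by symplectic forms
    (3 ≤ n → sympRestr (S hn μ) = (closedRestr (S hn μ) : Set (Restr (S hn μ)))) ∧
    (n = 2 →
      sympRestr (S hn μ) =
        {a | ∃ c : Fin μ → ℝ, a = restr (S hn μ) (∑ i : Fin μ, c i • θ hn (i.val + 1)) ∧
          (c ⟨0, by omega⟩, c ⟨1, by omega⟩, c ⟨2, by omega⟩) ≠ ((0, 0, 0) : ℝ × ℝ × ℝ)} ∧
      IsOpen {c : Fin μ → ℝ |
        restr (S hn μ) (∑ i : Fin μ, c i • θ hn (i.val + 1)) ∈ sympRestr (S hn μ)}) := by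
  have hsub : sympRestr (S hn μ) ⊆ (closedRestr (S hn μ) : Set (Restr (S hn μ))) := by
    rintro _ ⟨w, ⟨hw, -⟩, rfl⟩
    exact ⟨w, hw, rfl⟩
  refine ⟨⟨finrank_restr hμ, ?_⟩, ⟨?_, ?_⟩, ?_, ?_⟩
  · rw [eq_top_iff, Submodule.span_image]
    rintro a -
    obtain ⟨g, rfl⟩ := Submodule.mkQ_surjective _ a
    obtain ⟨c, r, h⟩ := exists_sub_mem_zeroRestr hn hμ g
    refine ⟨thetaComb hn μ c + r • σ₁ hn, ?_, restr_eq_iff.2 h⟩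
    refine add_mem ?_ (Submodule.smul_mem _ _ (Submodule.subset_span (by simp)))
    rw [thetaComb_apply]
    refine sum_mem fun i _ => Submodule.smul_mem _ _ ?_
    obtain ⟨i, hi⟩ := i
    match i with
    | 0 => exact Submodule.subset_span (by simp)
    | 1 => exact Submodule.subset_span (by simp)
    | 2 => exact Submodule.subset_span (by simp)
    -- θ_4 is not in the listed spanning set; it is σ_1 - σ_2.
    | 3 => exact sub_mem (Submodule.subset_span (by simp)) (Submodule.subset_span (by simp))
    | k + 4 =>
      exact Submodule.subset_span (Or.inr ⟨k + 1, by omega, by omega, congrArg (θ hn)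
        (show k + 4 + 1 = 4 + (k + 1) by omega)⟩)
  · rw [closedRestr_eq_range hμ, LinearMap.finrank_range_of_inj (restr_thetaComb_injective hμ)]
    simp
  · rw [closedRestr_eq_range hμ, LinearMap.range_comp, Submodule.span_image, thetaComb,
      Fintype.range_linearCombination]
    congr 2
    ext w
    constructor
    · rintro ⟨j, h1, h2, rfl⟩
      exact ⟨⟨j - 1, by omega⟩, congrArg (θ hn) (Nat.sub_add_cancel h1)⟩
    · rintro ⟨i, rfl⟩
      exact ⟨i.val + 1, by omega, by omega, rfl⟩
  · intro h3
    refine hsub.antisymm ?_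
    rintro _ ⟨g, hg, rfl⟩
    obtain ⟨c, hc⟩ := exists_restr_eq_of_closed hn hμ hg
    rw [← restr_eq_iff.2 hc]
    exact restr_thetaComb_mem_sympRestr_of_three_le h3 c
  · rintro rfl
    constructor
    · ext a
      constructor
      · intro ha
        obtain ⟨g, hg, rfl⟩ := hsub ha
        obtain ⟨c, hc⟩ := exists_restr_eq_of_closed hn hμ hg
        rw [← restr_eq_iff.2 hc] at ha ⊢
        exact ⟨c, rfl, ne_of_restr_thetaComb_mem_sympRestr hμ c rfl rfl rfl ha⟩
      · rintro ⟨c, rfl, hc⟩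
        exact restr_thetaComb_mem_sympRestr_of_ne c rfl rfl rfl hc
    -- In the coordinates c the set is the complement of the subspace c_1 = c_2 = c_3 = 0, hence
    -- open.
    · have : {c : Fin μ → ℝ | restr (S hn μ) (∑ i : Fin μ, c i • θ hn (i.val + 1)) ∈
          sympRestr (S hn μ)} = {c | (c ⟨0, by omega⟩, c ⟨1, by omega⟩, c ⟨2, by omega⟩) ≠
            ((0, 0, 0) : ℝ × ℝ × ℝ)} := by
        ext c
        exact ⟨ne_of_restr_thetaComb_mem_sympRestr hμ c rfl rfl rfl,
          restr_thetaComb_mem_sympRestr_of_ne c rfl rfl rfl⟩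
      rw [this]
      exact isOpen_ne_fun (by fun_prop) continuous_const
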